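/- Let $0<\epsilon<M$, $T>0$ and $0<\underline c<\overline c$, and let $c\in C^3(\mathbb R)$ satisfy $c(x)\in[\underline c,\overline c]$ for $x\in[\epsilon,M]$ and $c(x)=1$ for $x\notin[\epsilon,M]$. Put $\tau(x)=\int_0^x\sqrt{c(s)}\,ds$. Let $u$ be a locally integrable weak solution on $\mathbb R\times[0,\infty)$ of $$c(x)u_{tt}=u_{xx},\qquad u(x,0)=0,\qquad u_t(x,0)=\delta_0(x),$$ that is, $\int_0^\infty\!\int_{\mathbb R}u\,(c\,\varphi_{tt}-\varphi_{xx})\,dx\,dt=c(0)\varphi(0,0)$ for all $\varphi\in C_c^\infty(\mathbb R^2)$. Then, after modification on a null set, $u$ is continuous on $\{t\ge|\tau(x)|\}$ (its value on the front $t=|\tau(x)|$ being the limit from behind the front) and zero for $t<|\tau(x)|$. For this version of $u$ let $$q(x,t)=u(x,t+\tau(x)),\qquad g_0(t)=u(\epsilon,t),\qquad g_1(t)=u_x(\epsilon,t).$$ Then $q$ is of class $C^2$ on $(0,\infty)\times[0,\infty)$, and 1. $\displaystyle q_{xx}(x,t)-\frac{q_{xt}(x,t)}{2q^2(x,0)}+\frac{q_t(x,t)\,q_x(x,0)}{2q^3(x,0)}=0$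 for $(x,t)\in(\epsilon,M)\times(0,T)$; 2. $\displaystyle q(x,0)\ge\frac1{2\overline c^{1/4}}>0$ for $x\in[\epsilon,M]$; 3. $q(\epsilon,t)=g_0(t+\epsilon)$ for $t\in[0,T]$; 4. $q_x(\epsilon,t)=g_1(t+\epsilon)+g_0'(t+\epsilon)$ for $t\in[0,T]$, where for $t>0$ the derivatives $u_x(\epsilon,t+\epsilon)$ and $g_0'(t+\epsilon)$ exist, and for $t=0$ the values $g_1(\epsilon)$ and $g_0'(\epsilon)$ are understood as limits from the right, which exist; 5. $q_x(M,t)=0$ for $t\in[0,T]$; 6. $\displaystyle c(x)=\frac1{16\,q^4(x,0)}$ for $x\in[\epsilon,M]$. -/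

import Mathlib

open Set Filter Topology MeasureTheory
open scoped ContDiff

/-- The travel time `τ(x) = ∫₀ˣ √c(s) ds` from the source at `0` to `x` (signed). -/
noncomputable def travelTime (c : ℝ → ℝ) (x : ℝ) : ℝ :=
  ∫ s in (0 : ℝ)..x, Real.sqrt (c s)

/-- `u` is a locally integrable weak (distributional) solution on `ℝ × [0, ∞)` of
`c(x) u_tt = u_xx`, `u(x, 0) = 0`, `u_t(x, 0) = δ₀(x)`.
The test functions need not vanish at `t = 0`, so that integrating by parts twice in `t`
encodes both initial conditions: the boundary term is `∫ c(x) δ₀(x) φ(x, 0) dx = c(0) φ(0, 0)`. -/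
structure IsWeakWaveSolution (c : ℝ → ℝ) (u : ℝ → ℝ → ℝ) : Prop where
  locallyIntegrable :
    LocallyIntegrableOn (fun p : ℝ × ℝ => u p.1 p.2) (univ ×ˢ Ici 0) volume
  weak_eq : ∀ φ : ℝ × ℝ → ℝ, ContDiff ℝ ∞ φ → HasCompactSupport φ →
    ∫ p in (univ : Set ℝ) ×ˢ Ioi (0 : ℝ),
        u p.1 p.2 * (c p.1 * iteratedDeriv 2 (fun t => φ (p.1, t)) p.2
          - iteratedDeriv 2 (fun x => φ (x, p.2)) p.1)
      = c 0 * φ (0, 0)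

/-- `U` is the pointwise version of the (almost everywhere defined) function `u`: it is continuous
behind the wave front and up to it, that is on `{t ≥ |τ(x)|}`, and it is zero ahead of the front.
In particular its value on the front is the limit from behind,
`U(x, |τ(x)|) = lim_{t → |τ(x)|⁺} U(x, t)`.
These conditions determine `U` uniquely. -/
structure IsPointwiseVersion (c : ℝ → ℝ) (u U : ℝ → ℝ → ℝ) : Prop where
  ae_eq : (fun p : ℝ × ℝ => U p.1 p.2)
    =ᵐ[volume.restrict ((univ : Set ℝ) ×ˢ Ioi (0 : ℝ))] fun p => u p.1 p.2
  continuousOn : ContinuousOn (fun p : ℝ × ℝ => U p.1 p.2) {p | |travelTime c p.1| ≤ p.2}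
  eq_zero : ∀ x t, t < |travelTime c x| → U x t = 0

/-!
In the characteristic coordinates `(t + τ(x), t - τ(x))` the Liouville transform `u = a V`, with
amplitude `a = c ^ (-1/4)`, turns `c u_tt = u_xx` into `∂₁∂₂V = κ V` for a potential `κ` built from
`a`. Let `V` solve the Goursat problem whose data are constant on both characteristics through the
origin, the constant being the jump created by the source. Behind the front, the solution is
`a V`: in the weak equation one may test with solutions of the backward Goursat problem for
arbitrary sources, so Green's formula on the characteristic quadrant leaves no room for a second
weak solution.

In retarded time the front becomes `t = 0`, where `q(x, 0) = a(x) / 2`. Hence the trace of `q` on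
the front recovers `c`, and the differential equation for `q` is the wave equation in retarded
time with `√c` expressed by that trace. To the right of `M` the medium is homogeneous, so the
potential vanishes along the incoming characteristics, `∂₁V = 0` there, and no wave travels back
through `M`.
-/

section PartialDerivatives

variable {E : Type*} [NormedAddCommGroup E] [NormedSpace ℝ E]

/-- The partial derivative of `g` in its first variable. -/
noncomputable def partialFst (g : ℝ × ℝ → E) (p : ℝ × ℝ) : E := fderiv ℝ g p (1, 0)

/-- The partial derivative of `g` in its second variable. -/
noncomputable def partialSnd (g : ℝ × ℝ → E) (p : ℝ × ℝ) : E := fderiv ℝ g p (0, 1)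

variable {f f₁ f₂ g : ℝ × ℝ → E}

theorem hasFDerivAt_of_continuous_partials
    (h₁ : ∀ p : ℝ × ℝ, HasDerivAt (fun s => f (s, p.2)) (f₁ p) p.1)
    (h₂ : ∀ p : ℝ × ℝ, HasDerivAt (fun r => f (p.1, r)) (f₂ p) p.2)
    (hf₁ : Continuous f₁) (hf₂ : Continuous f₂) (p : ℝ × ℝ) :
    HasFDerivAt f ((ContinuousLinearMap.fst ℝ ℝ ℝ).smulRight (f₁ p)
      + (ContinuousLinearMap.snd ℝ ℝ ℝ).smulRight (f₂ p)) p := by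
  have hcont : Continuous (ContinuousLinearMap.toSpanSingleton ℝ : E → ℝ →L[ℝ] E) :=
    (ContinuousLinearMap.toSpanSingletonCLE (𝕜 := ℝ) (E := E)).continuous
  have h := (hasStrictFDerivAt_uncurry_coprod (𝕜 := ℝ) (u := p) (f := fun x y => f (x, y))
    (f₁ := fun x y => ContinuousLinearMap.toSpanSingleton ℝ (f₁ (x, y)))
    (f₂ := fun x y => ContinuousLinearMap.toSpanSingleton ℝ (f₂ (x, y)))
    (Eventually.of_forall fun q => (h₁ q).hasFDerivAt)
    (Eventually.of_forall fun q => (h₂ q).hasFDerivAt)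
    (hcont.comp hf₁).continuousAt (hcont.comp hf₂).continuousAt).hasFDerivAt
  convert! h using 1

theorem contDiff_succ_of_partials {n : ℕ}
    (h₁ : ∀ p : ℝ × ℝ, HasDerivAt (fun s => f (s, p.2)) (f₁ p) p.1)
    (h₂ : ∀ p : ℝ × ℝ, HasDerivAt (fun r => f (p.1, r)) (f₂ p) p.2)
    (hf₁ : ContDiff ℝ n f₁) (hf₂ : ContDiff ℝ n f₂) : ContDiff ℝ (n + 1) f := by
  have h := hasFDerivAt_of_continuous_partials h₁ h₂ hf₁.continuous hf₂.continuous
  refine contDiff_succ_iff_fderiv.2 ⟨fun p => (h p).differentiableAt, by simp, ?_⟩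
  rw [funext fun p => (h p).fderiv]
  fun_prop

theorem hasDerivAt_comp_curve {α β : ℝ → ℝ} {α' β' x : ℝ}
    (hg : DifferentiableAt ℝ g (α x, β x)) (hα : HasDerivAt α α' x) (hβ : HasDerivAt β β' x) :
    HasDerivAt (fun y => g (α y, β y))
      (α' • partialFst g (α x, β x) + β' • partialSnd g (α x, β x)) x := by
  refine (hg.hasFDerivAt.comp_hasDerivAt x (hα.prodMk hβ)).congr_deriv ?_
  rw [partialFst, partialSnd, ← map_smul, ← map_smul, ← map_add]
  simp

theorem hasDerivAt_partialFst {p : ℝ × ℝ} (hg : DifferentiableAt ℝ g p) :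
    HasDerivAt (fun s => g (s, p.2)) (partialFst g p) p.1 := by
  simpa using hasDerivAt_comp_curve (α := id) (β := fun _ => p.2) hg
    (hasDerivAt_id p.1) (hasDerivAt_const p.1 p.2)

theorem hasDerivAt_partialSnd {p : ℝ × ℝ} (hg : DifferentiableAt ℝ g p) :
    HasDerivAt (fun r => g (p.1, r)) (partialSnd g p) p.2 := by
  simpa using hasDerivAt_comp_curve (α := fun _ => p.1) (β := id) hg
    (hasDerivAt_const p.2 p.1) (hasDerivAt_id p.2)

theorem contDiff_partialFst {m n : WithTop ℕ∞} (hg : ContDiff ℝ m g) (hmn : n + 1 ≤ m) :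
    ContDiff ℝ n (partialFst g) :=
  (hg.fderiv_right hmn).clm_apply contDiff_const

theorem contDiff_partialSnd {m n : WithTop ℕ∞} (hg : ContDiff ℝ m g) (hmn : n + 1 ≤ m) :
    ContDiff ℝ n (partialSnd g) :=
  (hg.fderiv_right hmn).clm_apply contDiff_const

theorem hasCompactSupport_partialFst (hg : HasCompactSupport g) :
    HasCompactSupport (partialFst g) :=
  hg.fderiv_apply ℝ (1, 0)

theorem hasCompactSupport_partialSnd (hg : HasCompactSupport g) :
    HasCompactSupport (partialSnd g) :=
  hg.fderiv_apply ℝ (0, 1)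

theorem eventuallyEq_partialFst {p : ℝ × ℝ} (h : f =ᶠ[𝓝 p] g) :
    partialFst f =ᶠ[𝓝 p] partialFst g :=
  h.fderiv.fun_comp fun L => L (1, 0)

theorem eventuallyEq_partialSnd {p : ℝ × ℝ} (h : f =ᶠ[𝓝 p] g) :
    partialSnd f =ᶠ[𝓝 p] partialSnd g :=
  h.fderiv.fun_comp fun L => L (0, 1)

theorem partialFst_partialSnd_comm (hg : ContDiff ℝ 2 g) (p : ℝ × ℝ) :
    partialFst (partialSnd g) p = partialSnd (partialFst g) p := by
  have hd : DifferentiableAt ℝ (fderiv ℝ g) p :=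
    (hg.fderiv_right (m := 1) (by norm_num)).differentiable one_ne_zero p
  have hsecond : ∀ v w : ℝ × ℝ,
      fderiv ℝ (fun q => fderiv ℝ g q v) p w = fderiv ℝ (fderiv ℝ g) p w v := fun v w => by
    simp [fderiv_clm_apply hd (differentiableAt_const v)]
  change fderiv ℝ (fun q => fderiv ℝ g q (0, 1)) p (1, 0)
    = fderiv ℝ (fun q => fderiv ℝ g q (1, 0)) p (0, 1)
  rw [hsecond, hsecond]
  exact hg.contDiffAt.isSymmSndFDerivAt (by simp) _ _

theorem deriv_eq_partialFst (hg : Differentiable ℝ g) (t : ℝ) :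
    deriv (fun x => g (x, t)) = fun x => partialFst g (x, t) :=
  funext fun x => (hasDerivAt_partialFst (hg (x, t))).deriv

theorem deriv_eq_partialSnd (hg : Differentiable ℝ g) (x : ℝ) :
    deriv (fun t => g (x, t)) = fun t => partialSnd g (x, t) :=
  funext fun t => (hasDerivAt_partialSnd (hg (x, t))).deriv

theorem iteratedDeriv_two_eq_partialFst (hg : ContDiff ℝ 2 g) (t : ℝ) :
    iteratedDeriv 2 (fun x => g (x, t)) = fun x => partialFst (partialFst g) (x, t) := by
  rw [iteratedDeriv_succ, iteratedDeriv_one,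
    deriv_eq_partialFst (hg.differentiable two_ne_zero),
    deriv_eq_partialFst ((contDiff_partialFst hg le_rfl).differentiable one_ne_zero)]

theorem iteratedDeriv_two_eq_partialSnd (hg : ContDiff ℝ 2 g) (x : ℝ) :
    iteratedDeriv 2 (fun t => g (x, t)) = fun t => partialSnd (partialSnd g) (x, t) := by
  rw [iteratedDeriv_succ, iteratedDeriv_one,
    deriv_eq_partialSnd (hg.differentiable two_ne_zero),
    deriv_eq_partialSnd ((contDiff_partialSnd hg le_rfl).differentiable one_ne_zero)]

end PartialDerivatives

section Primitives

variable {E : Type*} [NormedAddCommGroup E] {G H : ℝ × ℝ → E}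

theorem intervalIntegrable_fst (hG : Continuous G) (r a b : ℝ) :
    IntervalIntegrable (fun s => G (s, r)) volume a b :=
  (hG.comp (by fun_prop : Continuous fun s => (s, r))).intervalIntegrable _ _

theorem intervalIntegrable_snd (hG : Continuous G) (s a b : ℝ) :
    IntervalIntegrable (fun r => G (s, r)) volume a b :=
  (hG.comp (by fun_prop : Continuous fun r => (s, r))).intervalIntegrable _ _

variable [NormedSpace ℝ E]

/-- The primitive of `G` in the first variable that vanishes on the line `s = a`. -/
noncomputable def primitiveFst (a : ℝ) (G : ℝ × ℝ → E) (p : ℝ × ℝ) : E :=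
  ∫ s in a..p.1, G (s, p.2)

/-- The primitive of `G` in the second variable that vanishes on the line `r = b`. -/
noncomputable def primitiveSnd (b : ℝ) (G : ℝ × ℝ → E) (p : ℝ × ℝ) : E :=
  ∫ r in b..p.2, G (p.1, r)

variable {a b : ℝ}

theorem continuous_primitiveSnd (hG : Continuous G) : Continuous (primitiveSnd b G) :=
  intervalIntegral.continuous_parametric_intervalIntegral_of_continuous
    (f := fun p r => G (p.1, r)) (s := Prod.snd) (by fun_prop) continuous_snd

theorem continuous_primitiveFst (hG : Continuous G) : Continuous (primitiveFst a G) :=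
  (continuous_primitiveSnd (hG.comp continuous_swap)).comp continuous_swap

theorem primitiveFst_primitiveSnd_sub (hG : Continuous G) (hH : Continuous H) (p : ℝ × ℝ) :
    primitiveFst a (primitiveSnd b fun q => G q - H q) p
      = primitiveFst a (primitiveSnd b G) p - primitiveFst a (primitiveSnd b H) p := by
  have hSnd : (primitiveSnd b fun q => G q - H q) = fun q =>
      primitiveSnd b G q - primitiveSnd b H q := funext fun q =>
    intervalIntegral.integral_sub (intervalIntegrable_snd hG _ _ _)
      (intervalIntegrable_snd hH _ _ _)
  rw [hSnd]
  exact intervalIntegral.integral_sub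
    (intervalIntegrable_fst (continuous_primitiveSnd hG) _ _ _)
    (intervalIntegrable_fst (continuous_primitiveSnd hH) _ _ _)

theorem primitiveFst_eq_zero (h : ∀ p : ℝ × ℝ, a ≤ p.1 ∨ b ≤ p.2 → G p = 0)
    {p : ℝ × ℝ} (hp : a ≤ p.1 ∨ b ≤ p.2) : primitiveFst a G p = 0 := by
  refine intervalIntegral.integral_zero_ae (Eventually.of_forall fun s hs => h _ ?_)
  refine hp.imp_left fun ha => ?_
  rw [uIoc_of_le ha] at hs
  exact hs.1.le

theorem primitiveSnd_eq_zero (h : ∀ p : ℝ × ℝ, a ≤ p.1 ∨ b ≤ p.2 → G p = 0)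
    {p : ℝ × ℝ} (hp : a ≤ p.1 ∨ b ≤ p.2) : primitiveSnd b G p = 0 :=
  primitiveFst_eq_zero (G := G ∘ Prod.swap) (p := p.swap) (fun q hq => h q.swap hq.symm) hp.symm

theorem hasDerivAt_primitiveSnd_fst {G' : ℝ × ℝ → E} (hG : Continuous G) (hG' : Continuous G')
    (h : ∀ p : ℝ × ℝ, HasDerivAt (fun s => G (s, p.2)) (G' p) p.1) (p : ℝ × ℝ) :
    HasDerivAt (fun s => primitiveSnd b G (s, p.2)) (primitiveSnd b G' p) p.1 := by
  obtain ⟨C, hC⟩ := ((isCompact_closedBall p.1 1).prod (isCompact_uIcc (a := b) (b := p.2))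
    ).exists_bound_of_continuousOn hG'.continuousOn
  exact (intervalIntegral.hasDerivAt_integral_of_dominated_loc_of_deriv_le
    (F := fun s r => G (s, r)) (F' := fun s r => G' (s, r)) (bound := fun _ => C)
    (Metric.closedBall_mem_nhds p.1 one_pos)
    (Eventually.of_forall fun s =>
      (hG.comp (by fun_prop : Continuous fun r => (s, r))).aestronglyMeasurable)
    (intervalIntegrable_snd hG _ _ _)
    (hG'.comp (by fun_prop : Continuous fun r => (p.1, r))).aestronglyMeasurable
    (Eventually.of_forall fun r hr s hs => hC (s, r) ⟨hs, uIoc_subset_uIcc hr⟩)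
    intervalIntegrable_const
    (Eventually.of_forall fun r _ s _ => h (s, r))).2

variable [CompleteSpace E]

theorem hasDerivAt_primitiveSnd (hG : Continuous G) (p : ℝ × ℝ) :
    HasDerivAt (fun r => primitiveSnd b G (p.1, r)) (G p) p.2 :=
  (hG.comp (by fun_prop : Continuous fun r => (p.1, r))).integral_hasStrictDerivAt b p.2
    |>.hasDerivAt

theorem hasDerivAt_primitiveFst (hG : Continuous G) (p : ℝ × ℝ) :
    HasDerivAt (fun s => primitiveFst a G (s, p.2)) (G p) p.1 :=
  hasDerivAt_primitiveSnd (hG.comp continuous_swap) p.swap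

theorem contDiff_one_primitiveSnd (hG : ContDiff ℝ 1 G) : ContDiff ℝ 1 (primitiveSnd b G) := by
  have hG₁ : Continuous (partialFst G) := (contDiff_partialFst (n := 0) hG (by simp)).continuous
  have h := contDiff_succ_of_partials (n := 0) (f := primitiveSnd b G)
    (hasDerivAt_primitiveSnd_fst hG.continuous hG₁
      fun p => hasDerivAt_partialFst (hG.differentiable one_ne_zero p))
    (hasDerivAt_primitiveSnd hG.continuous) (contDiff_zero.2 (continuous_primitiveSnd hG₁))
    (contDiff_zero.2 hG.continuous)
  simpa using h

theorem contDiff_one_primitiveFst (hG : ContDiff ℝ 1 G) : ContDiff ℝ 1 (primitiveFst a G) :=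
  (contDiff_one_primitiveSnd (hG.comp (contDiff_snd.prodMk contDiff_fst))).comp
    (contDiff_snd.prodMk contDiff_fst)

theorem hasDerivAt_primitiveFst_primitiveSnd (hG : Continuous G) (p : ℝ × ℝ) :
    HasDerivAt (fun r => primitiveFst a (primitiveSnd b G) (p.1, r)) (primitiveFst a G p) p.2 :=
  hasDerivAt_primitiveSnd_fst ((continuous_primitiveSnd hG).comp continuous_swap)
    (hG.comp continuous_swap) (fun q => hasDerivAt_primitiveSnd hG q.swap) p.swap

theorem contDiff_succ_primitiveFst_primitiveSnd {n : ℕ} (hG : Continuous G)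
    (h₁ : ContDiff ℝ n (primitiveSnd b G)) (h₂ : ContDiff ℝ n (primitiveFst a G)) :
    ContDiff ℝ (n + 1) (primitiveFst a (primitiveSnd b G)) :=
  contDiff_succ_of_partials (hasDerivAt_primitiveFst (continuous_primitiveSnd hG))
    (hasDerivAt_primitiveFst_primitiveSnd hG) h₁ h₂

theorem contDiff_one_primitiveFst_primitiveSnd (hG : Continuous G) :
    ContDiff ℝ 1 (primitiveFst a (primitiveSnd b G)) := by
  simpa using contDiff_succ_primitiveFst_primitiveSnd (n := 0) hG
    (contDiff_zero.2 (continuous_primitiveSnd hG)) (contDiff_zero.2 (continuous_primitiveFst hG))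

theorem contDiff_two_primitiveFst_primitiveSnd (hG : ContDiff ℝ 1 G) :
    ContDiff ℝ 2 (primitiveFst a (primitiveSnd b G)) := by
  simpa [one_add_one_eq_two] using contDiff_succ_primitiveFst_primitiveSnd (n := 1) hG.continuous
    (contDiff_one_primitiveSnd hG) (contDiff_one_primitiveFst hG)

end Primitives

section Goursat

open scoped NNReal BoundedContinuousFunction

variable {E : Type*} [NormedAddCommGroup E] [NormedSpace ℝ E]

/-- The weight `cosh (l (s - a)) cosh (l (r - b))` on the plane, centred at `p₀ = (a, b)`. In the
supremum norm weighted by it, double integration from `p₀` has norm at most `l⁻²`. -/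
noncomputable def coshWeight (l : ℝ) (p₀ p : ℝ × ℝ) : ℝ :=
  Real.cosh (l * (p.1 - p₀.1)) * Real.cosh (l * (p.2 - p₀.2))

theorem one_le_coshWeight (l : ℝ) (p₀ p : ℝ × ℝ) : 1 ≤ coshWeight l p₀ p :=
  one_le_mul_of_one_le_of_one_le (Real.one_le_cosh _) (Real.one_le_cosh _)

theorem coshWeight_pos (l : ℝ) (p₀ p : ℝ × ℝ) : 0 < coshWeight l p₀ p :=
  one_pos.trans_le (one_le_coshWeight l p₀ p)

theorem continuous_coshWeight (l : ℝ) (p₀ : ℝ × ℝ) : Continuous (coshWeight l p₀) := by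
  unfold coshWeight
  fun_prop

theorem norm_integral_le_cosh {g : ℝ → E} {l C a : ℝ} (hl : 0 < l) (hC : 0 ≤ C)
    (hg : ∀ s, ‖g s‖ ≤ C * Real.cosh (l * (s - a))) (x : ℝ) :
    ‖∫ s in a..x, g s‖ ≤ C / l * Real.cosh (l * (x - a)) := by
  have hderiv : ∀ s : ℝ, HasDerivAt (fun s => C / l * Real.sinh (l * (s - a)))
      (C * Real.cosh (l * (s - a))) s := fun s => by
    refine (((((hasDerivAt_id s).sub_const a).const_mul l).sinh).const_mul (C / l)).congr_deriv ?_
    simp only [id_eq]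
    field_simp
  have hint : IntervalIntegrable (fun s => C * Real.cosh (l * (s - a))) volume a x :=
    (by fun_prop : Continuous fun s => C * Real.cosh (l * (s - a))).intervalIntegrable _ _
  have habs_sinh : |Real.sinh (l * (x - a))| ≤ Real.cosh (l * (x - a)) := by
    rw [Real.abs_sinh, ← Real.cosh_abs]
    exact (Real.sinh_lt_cosh _).le
  calc ‖∫ s in a..x, g s‖ ≤ |∫ s in a..x, C * Real.cosh (l * (s - a))| :=
        intervalIntegral.norm_integral_le_abs_of_norm_le (Eventually.of_forall hg) hint
    _ = C / l * |Real.sinh (l * (x - a))| := by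
        rw [intervalIntegral.integral_eq_sub_of_hasDerivAt (fun s _ => hderiv s) hint]
        simp [abs_mul, abs_div, abs_of_nonneg hC, abs_of_pos hl]
    _ ≤ C / l * Real.cosh (l * (x - a)) := by gcongr

theorem norm_primitiveFst_primitiveSnd_le {G : ℝ × ℝ → E} {l C : ℝ} {p₀ : ℝ × ℝ} (hl : 0 < l)
    (hC : 0 ≤ C) (hG : ∀ p, ‖G p‖ ≤ C * coshWeight l p₀ p) (p : ℝ × ℝ) :
    ‖primitiveFst p₀.1 (primitiveSnd p₀.2 G) p‖ ≤ C / l ^ 2 * coshWeight l p₀ p := by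
  have hSnd : ∀ s, ‖primitiveSnd p₀.2 G (s, p.2)‖
      ≤ C / l * Real.cosh (l * (p.2 - p₀.2)) * Real.cosh (l * (s - p₀.1)) := fun s => by
    refine (norm_integral_le_cosh hl (mul_nonneg hC (Real.cosh_pos (l * (s - p₀.1))).le)
      (fun r => (hG (s, r)).trans_eq ?_) p.2).trans_eq ?_
    · simp only [coshWeight]; ring
    · ring
  refine (norm_integral_le_cosh hl (mul_nonneg (by positivity) (Real.cosh_pos _).le)
    hSnd p.1).trans_eq ?_
  rw [coshWeight]
  field_simp

theorem exists_bounded_coshWeight_smul_eq {G : ℝ × ℝ → E} {l C : ℝ} {p₀ : ℝ × ℝ} (hl : 0 < l)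
    (hC : 0 ≤ C) (hGc : Continuous G) (hG : ∀ p, ‖G p‖ ≤ C * coshWeight l p₀ p) :
    ∃ Y : ℝ × ℝ →ᵇ E, ∀ p,
      coshWeight l p₀ p • Y p = primitiveFst p₀.1 (primitiveSnd p₀.2 G) p := by
  have hw := coshWeight_pos l p₀
  refine ⟨BoundedContinuousFunction.ofNormedAddCommGroup
    (fun p => (coshWeight l p₀ p)⁻¹ • primitiveFst p₀.1 (primitiveSnd p₀.2 G) p)
    (((continuous_coshWeight l p₀).inv₀ fun p => (hw p).ne').smul
      (continuous_primitiveFst (continuous_primitiveSnd hGc))) (C / l ^ 2) fun p => ?_,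
    fun p => smul_inv_smul₀ (hw p).ne' _⟩
  rw [norm_smul, norm_inv, Real.norm_of_nonneg (hw p).le, inv_mul_le_iff₀' (hw p)]
  exact norm_primitiveFst_primitiveSnd_le hl hC hG p

variable {f : ℝ × ℝ → E → E} {w₀ : E} {p₀ : ℝ × ℝ} {K : ℝ≥0} {C : ℝ}

theorem norm_sub_coshWeight_smul_le (hlip : ∀ p, LipschitzWith K (f p)) (l : ℝ)
    (Z Y : ℝ × ℝ →ᵇ E) (p : ℝ × ℝ) :
    ‖f p (w₀ + coshWeight l p₀ p • Z p) - f p (w₀ + coshWeight l p₀ p • Y p)‖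
      ≤ K * dist Z Y * coshWeight l p₀ p := by
  have hw := (coshWeight_pos l p₀ p).le
  calc _ ≤ K * ‖(w₀ + coshWeight l p₀ p • Z p) - (w₀ + coshWeight l p₀ p • Y p)‖ :=
        (hlip p).norm_sub_le _ _
    _ = K * dist (Z p) (Y p) * coshWeight l p₀ p := by
        rw [add_sub_add_left_eq_sub, ← smul_sub, norm_smul, Real.norm_of_nonneg hw, dist_eq_norm]
        ring
    _ ≤ K * dist Z Y * coshWeight l p₀ p := by
        gcongr
        exact Z.dist_coe_le_dist p

theorem norm_coshWeight_smul_le (hlip : ∀ p, LipschitzWith K (f p)) (hC : ∀ p, ‖f p w₀‖ ≤ C)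
    (l : ℝ) (Z : ℝ × ℝ →ᵇ E) (p : ℝ × ℝ) :
    ‖f p (w₀ + coshWeight l p₀ p • Z p)‖ ≤ (K * dist Z 0 + C) * coshWeight l p₀ p := by
  have hC₀ : 0 ≤ C := (norm_nonneg _).trans (hC 0)
  have hdiff : ‖f p (w₀ + coshWeight l p₀ p • Z p) - f p w₀‖
      ≤ K * dist Z 0 * coshWeight l p₀ p := by
    simpa using norm_sub_coshWeight_smul_le hlip l Z 0 p
  calc _ ≤ ‖f p (w₀ + coshWeight l p₀ p • Z p) - f p w₀‖ + ‖f p w₀‖ := norm_le_norm_sub_add _ _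
    _ ≤ K * dist Z 0 * coshWeight l p₀ p + C * coshWeight l p₀ p :=
        add_le_add hdiff ((hC p).trans (le_mul_of_one_le_right hC₀ (one_le_coshWeight l p₀ p)))
    _ = _ := by ring

theorem exists_contracting_volterra (hf : Continuous (Function.uncurry f))
    (hlip : ∀ p, LipschitzWith K (f p)) (hC : ∀ p, ‖f p w₀‖ ≤ C) :
    ∃ T : (ℝ × ℝ →ᵇ E) → (ℝ × ℝ →ᵇ E), ContractingWith (1 / 2) T ∧
      ∀ Z p, coshWeight (K + 1) p₀ p • T Z p = primitiveFst p₀.1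
        (primitiveSnd p₀.2 fun q => f q (w₀ + coshWeight (K + 1) p₀ q • Z q)) p := by
  have hl : (0 : ℝ) < K + 1 := by positivity
  have hC₀ : 0 ≤ C := (norm_nonneg _).trans (hC 0)
  have hcont : ∀ Z : ℝ × ℝ →ᵇ E,
      Continuous fun q => f q (w₀ + coshWeight (K + 1) p₀ q • Z q) := fun Z =>
    hf.comp (continuous_id.prodMk
      (continuous_const.add ((continuous_coshWeight _ p₀).smul Z.continuous)))
  choose T hT using fun Z : ℝ × ℝ →ᵇ E => exists_bounded_coshWeight_smul_eq hl
    (by positivity) (hcont Z) (norm_coshWeight_smul_le hlip hC (K + 1) Z)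
  refine ⟨T, ⟨by norm_num, LipschitzWith.of_dist_le_mul fun Z Y => ?_⟩, hT⟩
  refine (BoundedContinuousFunction.dist_le (by positivity)).2 fun p => ?_
  have hw := coshWeight_pos (K + 1) p₀ p
  have hcontract : (K : ℝ) / (K + 1) ^ 2 ≤ 1 / 2 := by
    rw [div_le_div_iff₀ (by positivity) two_pos]
    nlinarith [sq_nonneg (K : ℝ)]
  refine le_of_mul_le_mul_left ?_ hw
  calc coshWeight (K + 1) p₀ p * dist (T Z p) (T Y p)
      = ‖coshWeight (K + 1) p₀ p • T Z p - coshWeight (K + 1) p₀ p • T Y p‖ := by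
        rw [← smul_sub, norm_smul, Real.norm_of_nonneg hw.le, dist_eq_norm]
    _ ≤ K * dist Z Y / (K + 1) ^ 2 * coshWeight (K + 1) p₀ p := by
        rw [hT, hT, ← primitiveFst_primitiveSnd_sub (hcont Z) (hcont Y)]
        exact norm_primitiveFst_primitiveSnd_le hl (by positivity)
          (norm_sub_coshWeight_smul_le hlip (K + 1) Z Y) p
    _ = coshWeight (K + 1) p₀ p * (K / (K + 1) ^ 2 * dist Z Y) := by ring
    _ ≤ coshWeight (K + 1) p₀ p * ((1 / 2 : ℝ≥0) * dist Z Y) := by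
        push_cast
        gcongr

theorem exists_volterra [CompleteSpace E] (hf : Continuous (Function.uncurry f))
    (hlip : ∀ p, LipschitzWith K (f p)) (hC : ∀ p, ‖f p w₀‖ ≤ C) :
    ∃ W : ℝ × ℝ → E, Continuous W ∧
      (∀ p, W p = w₀ + primitiveFst p₀.1 (primitiveSnd p₀.2 fun q => f q (W q)) p) ∧
      ((∀ p : ℝ × ℝ, p₀.1 ≤ p.1 ∨ p₀.2 ≤ p.2 → f p w₀ = 0) →
        ∀ p : ℝ × ℝ, p₀.1 ≤ p.1 ∨ p₀.2 ≤ p.2 → W p = w₀) := by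
  obtain ⟨T, hTcontr, hT⟩ := exists_contracting_volterra (p₀ := p₀) hf hlip hC
  set Z := ContractingWith.fixedPoint T hTcontr
  refine ⟨fun p => w₀ + coshWeight (K + 1) p₀ p • Z p,
    continuous_const.add ((continuous_coshWeight _ p₀).smul Z.continuous), fun p => ?_,
    fun h₀ p hp => ?_⟩
  · rw [← hT Z p, hTcontr.fixedPoint_isFixedPt]
  · have hiterate : ∀ n : ℕ, ∀ q : ℝ × ℝ, p₀.1 ≤ q.1 ∨ p₀.2 ≤ q.2 → (T^[n] 0) q = 0 := by
      intro n
      induction n with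
      | zero => exact fun _ _ => rfl
      | succ n ih =>
        intro q hq
        rw [Function.iterate_succ_apply',
          ← smul_eq_zero_iff_right (coshWeight_pos (K + 1) p₀ q).ne', hT]
        refine primitiveFst_eq_zero (b := p₀.2) (fun q' hq' => primitiveSnd_eq_zero ?_ hq') hq
        intro q'' hq''
        rw [ih q'' hq'', smul_zero, add_zero, h₀ q'' hq'']
    have hlim : Tendsto (fun n => (T^[n] 0) p) atTop (𝓝 (Z p)) :=
      ((continuous_eval_const p).tendsto Z).comp (hTcontr.tendsto_iterate_fixedPoint 0)
    simp only [fun n => hiterate n p hp] at hlim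
    simp [← tendsto_nhds_unique tendsto_const_nhds hlim]

theorem exists_goursat [CompleteSpace E] (hf : ContDiff ℝ 1 (Function.uncurry f))
    (hlip : ∀ p, LipschitzWith K (f p)) (hC : ∀ p, ‖f p w₀‖ ≤ C) :
    ∃ W : ℝ × ℝ → E, ContDiff ℝ 2 W ∧ (∀ r, W (p₀.1, r) = w₀) ∧ (∀ s, W (s, p₀.2) = w₀) ∧
      (∀ p, partialSnd (partialFst W) p = f p (W p)) ∧
      ((∀ p : ℝ × ℝ, p₀.1 ≤ p.1 ∨ p₀.2 ≤ p.2 → f p w₀ = 0) →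
        ∀ p : ℝ × ℝ, p₀.1 ≤ p.1 ∨ p₀.2 ≤ p.2 → W p = w₀) := by
  obtain ⟨W, hWc, hW, hWconst⟩ := exists_volterra (p₀ := p₀) hf.continuous hlip hC
  set G : ℝ × ℝ → E := fun q => f q (W q)
  have hGc : Continuous G := hf.continuous.comp (continuous_id.prodMk hWc)
  have hWeq : W = fun p => w₀ + primitiveFst p₀.1 (primitiveSnd p₀.2 G) p := funext hW
  have hW1 : ContDiff ℝ 1 W :=
    hWeq ▸ contDiff_const.add (contDiff_one_primitiveFst_primitiveSnd hGc)
  have hG1 : ContDiff ℝ 1 G := hf.comp (contDiff_id.prodMk hW1)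
  have hW2 : ContDiff ℝ 2 W :=
    hWeq ▸ contDiff_const.add (contDiff_two_primitiveFst_primitiveSnd hG1)
  have hpartial : partialFst W = primitiveSnd p₀.2 G := funext fun p => by
    refine (hasDerivAt_partialFst (hW2.differentiable two_ne_zero p)).unique ?_
    rw [hWeq]
    exact (hasDerivAt_primitiveFst (continuous_primitiveSnd hGc) p).const_add w₀
  refine ⟨W, hW2, fun r => ?_, fun s => ?_, fun p => ?_, hWconst⟩
  · simp [hW, primitiveFst]
  · simp [hW, primitiveFst, primitiveSnd]
  · rw [hpartial]
    exact (hasDerivAt_partialSnd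
      ((hpartial ▸ contDiff_partialFst hW2 le_rfl).differentiable one_ne_zero p)).unique
      (hasDerivAt_primitiveSnd hGc p)

end Goursat

section Green

theorem partialFst_mul {g h : ℝ × ℝ → ℝ} {p : ℝ × ℝ} (hg : DifferentiableAt ℝ g p)
    (hh : DifferentiableAt ℝ h p) :
    partialFst (fun q => g q * h q) p = g p * partialFst h p + partialFst g p * h p := by
  simp [partialFst, fderiv_fun_mul hg hh, mul_comm (h p)]

theorem partialSnd_mul {g h : ℝ × ℝ → ℝ} {p : ℝ × ℝ} (hg : DifferentiableAt ℝ g p)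
    (hh : DifferentiableAt ℝ h p) :
    partialSnd (fun q => g q * h q) p = g p * partialSnd h p + partialSnd g p * h p := by
  simp [partialSnd, fderiv_fun_mul hg hh, mul_comm (h p)]

/-- The divergence theorem for the field `(-∂₂V · W, V · ∂₁W)`. -/
theorem integral_green_rectangle {V W : ℝ × ℝ → ℝ} (hV : ContDiff ℝ 2 V) (hW : ContDiff ℝ 2 W)
    {v S R : ℝ} (hV_left : ∀ r, V (0, r) = v) (hV_bot : ∀ s, V (s, 0) = v)
    (hW_right : ∀ r, W (S, r) = 0) (hW_top : ∀ s, W (s, R) = 0) :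
    ∫ s in (0 : ℝ)..S, ∫ r in (0 : ℝ)..R, (V (s, r) * partialSnd (partialFst W) (s, r)
        - partialSnd (partialFst V) (s, r) * W (s, r)) = v * W (0, 0) := by
  have hW₁ := contDiff_partialFst (n := 1) hW le_rfl
  have hV₂ := contDiff_partialSnd (n := 1) hV le_rfl
  have hV1 : ContDiff ℝ 1 V := hV.of_le one_le_two
  have hW1 : ContDiff ℝ 1 W := hW.of_le one_le_two
  have hWd := hW1.differentiable one_ne_zero
  set X : ℝ × ℝ → ℝ := fun p => -(partialSnd V p * W p) with hX
  set Y : ℝ × ℝ → ℝ := fun p => V p * partialFst W p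
  have hX1 : ContDiff ℝ 1 X := (hV₂.mul hW1).neg
  have hY1 : ContDiff ℝ 1 Y := hV1.mul hW₁
  have hdiv : ∀ p, V p * partialSnd (partialFst W) p - partialSnd (partialFst V) p * W p
      = partialFst X p + partialSnd Y p := fun p => by
    rw [partialSnd_mul (hV1.differentiable one_ne_zero p) (hW₁.differentiable one_ne_zero p),
      show partialFst X p = -partialFst (fun q => partialSnd V q * W q) p by
        simp [partialFst, hX, fderiv_fun_neg],
      partialFst_mul (hV₂.differentiable one_ne_zero p) (hWd p), partialFst_partialSnd_comm hV]
    ring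
  have hWtop : ∀ s, partialFst W (s, R) = 0 := fun s => by
    simpa [hW_top] using (hasDerivAt_partialFst (hWd (s, R))).deriv.symm
  have hVleft : ∀ r, partialSnd V (0, r) = 0 := fun r => by
    simpa [hV_left] using
      (hasDerivAt_partialSnd (hV1.differentiable one_ne_zero (0, r))).deriv.symm
  have hbot : ∫ s in (0 : ℝ)..S, partialFst W (s, 0) = -W (0, 0) := by
    rw [intervalIntegral.integral_eq_sub_of_hasDerivAt
      (f := fun s => W (s, 0)) (fun s _ => hasDerivAt_partialFst (hWd (s, 0)))
      (intervalIntegrable_fst hW₁.continuous 0 0 S), hW_right, zero_sub]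
  simp only [hdiv]
  refine (integral2_divergence_prod_of_hasFDerivAt X Y (fderiv ℝ X) (fderiv ℝ Y) 0 0 S R
    hX1.continuous.continuousOn hY1.continuous.continuousOn
    (fun p _ => (hX1.differentiable one_ne_zero p).hasFDerivAt)
    (fun p _ => (hY1.differentiable one_ne_zero p).hasFDerivAt)
    (((contDiff_partialFst (n := 0) hX1 (by simp)).continuous.add
      (contDiff_partialSnd (n := 0) hY1 (by simp)).continuous).continuousOn.integrableOn_compact
      (isCompact_uIcc.prod isCompact_uIcc))).trans ?_
  simp [X, Y, hWtop, hVleft, hW_right, hV_bot, hbot]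

theorem integral_green_quadrant {V W : ℝ × ℝ → ℝ} (hV : ContDiff ℝ 2 V) (hW : ContDiff ℝ 2 W)
    {v R : ℝ} (hV_left : ∀ r, V (0, r) = v) (hV_bot : ∀ s, V (s, 0) = v) (hR : 0 ≤ R)
    (hWR : ∀ q : ℝ × ℝ, R ≤ q.1 ∨ R ≤ q.2 → W q = 0) :
    ∫ q in Ici (0 : ℝ) ×ˢ Ici (0 : ℝ), (V q * partialSnd (partialFst W) q
        - partialSnd (partialFst V) q * W q) = v * W (0, 0) := by
  have hWzero : ∀ q : ℝ × ℝ, R < q.1 ∨ R < q.2 → W =ᶠ[𝓝 q] fun _ => 0 := fun q hq => by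
    filter_upwards [((isOpen_lt continuous_const continuous_fst).union
      (isOpen_lt continuous_const continuous_snd)).mem_nhds hq] with q' hq'
    exact hWR q' (hq'.imp le_of_lt le_of_lt)
  have hzero : ∀ q ∈ (Ici (0 : ℝ) ×ˢ Ici (0 : ℝ)) \ (Icc (0 : ℝ) R ×ˢ Icc (0 : ℝ) R),
      V q * partialSnd (partialFst W) q - partialSnd (partialFst V) q * W q = 0 := by
    rintro q ⟨⟨h₁, h₂⟩, hq⟩
    have hq' : R < q.1 ∨ R < q.2 := by
      by_contra! hle
      exact hq ⟨⟨h₁, hle.1⟩, ⟨h₂, hle.2⟩⟩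
    have hderiv : partialFst W =ᶠ[𝓝 q] fun _ => 0 :=
      (eventuallyEq_partialFst (hWzero q hq')).trans (.of_eq (by ext; simp [partialFst]))
    rw [(eventuallyEq_partialSnd hderiv).eq_of_nhds, (hWzero q hq').eq_of_nhds]
    simp [partialSnd]
  have hcont : ∀ {Z : ℝ × ℝ → ℝ}, ContDiff ℝ 2 Z → Continuous (partialSnd (partialFst Z)) :=
    fun hZ => (contDiff_partialSnd (n := 0) (contDiff_partialFst (n := 1) hZ le_rfl)
      (by simp)).continuous
  have hint : Continuous fun q => V q * partialSnd (partialFst W) q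
      - partialSnd (partialFst V) q * W q :=
    (hV.continuous.mul (hcont hW)).sub ((hcont hV).mul hW.continuous)
  rw [setIntegral_eq_of_subset_of_forall_sdiff_eq_zero (measurableSet_Ici.prod measurableSet_Ici)
      (prod_mono Icc_subset_Ici_self Icc_subset_Ici_self) hzero, Measure.volume_eq_prod,
    setIntegral_prod _ (hint.continuousOn.integrableOn_compact
      (isCompact_Icc.prod isCompact_Icc))]
  simp only [integral_Icc_eq_integral_Ioc, ← intervalIntegral.integral_of_le hR]
  exact integral_green_rectangle hV hW hV_left hV_bot (fun r => hWR (R, r) (Or.inl le_rfl))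
    fun s => hWR (s, R) (Or.inr le_rfl)

end Green

section Mollification

open scoped Convolution

variable {G F : Type*} [NormedAddCommGroup G] [NormedSpace ℝ G] [FiniteDimensional ℝ G]
  [NormedAddCommGroup F] [NormedSpace ℝ F]

/-- A smooth bump function at the origin, supported in the ball of radius `1 / (n + 1)`. -/
noncomputable def mollifierBump (n : ℕ) : ContDiffBump (0 : G) where
  rIn := 1 / (n + 1) / 2
  rOut := 1 / (n + 1)
  rIn_pos := by positivity
  rIn_lt_rOut := half_lt_self (by positivity)

variable [MeasurableSpace G] [BorelSpace G] (μ : Measure G) [μ.IsAddHaarMeasure]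

/-- The `n`-th mollification of `g`: its convolution with `mollifierBump n`, normalized to have
integral one. -/
noncomputable def mollify (n : ℕ) (g : G → F) : G → F :=
  (mollifierBump n).normed μ ⋆[ContinuousLinearMap.lsmul ℝ ℝ, μ] g

variable {g : G → F}

theorem contDiff_mollify (hg : LocallyIntegrable g μ) (n : ℕ) : ContDiff ℝ ∞ (mollify μ n g) :=
  (mollifierBump n).hasCompactSupport_normed.contDiff_convolution_left _
    (mollifierBump n).contDiff_normed hg

theorem hasCompactSupport_mollify (hgc : HasCompactSupport g) (n : ℕ) :
    HasCompactSupport (mollify μ n g) :=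
  (mollifierBump n).hasCompactSupport_normed.convolution _ hgc

theorem fderiv_mollify_apply (hg : ContDiff ℝ 1 g) (hgc : HasCompactSupport g) (n : ℕ) (p v : G) :
    fderiv ℝ (mollify μ n g) p v = mollify μ n (fun q => fderiv ℝ g q v) p := by
  have hbump : LocallyIntegrable ((mollifierBump (G := G) n).normed μ) μ :=
    (mollifierBump n).continuous_normed.locallyIntegrable
  have h := hgc.hasFDerivAt_convolution_right (ContinuousLinearMap.lsmul ℝ ℝ) hbump hg p
  rw [mollify, h.fderiv, convolution_precompR_apply _ hbump (hgc.fderiv ℝ)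
    (hg.continuous_fderiv one_ne_zero), mollify]

variable [CompleteSpace F]

theorem tendsto_mollify (hg : Continuous g) (p : G) :
    Tendsto (fun n => mollify μ n g p) atTop (𝓝 (g p)) :=
  ContDiffBump.convolution_tendsto_right_of_continuous tendsto_one_div_add_atTop_nhds_zero_nat hg p

theorem norm_mollify_le (hg : Continuous g) {C : ℝ} (hC : 0 ≤ C) {p : G}
    (h : ∀ q ∈ Metric.ball p 1, ‖g q‖ ≤ C) (n : ℕ) : ‖mollify μ n g p‖ ≤ C := by
  have hrOut : (mollifierBump (G := G) n).rOut ≤ 1 :=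
    div_le_one_of_le₀ (by simp) (by positivity)
  simpa [mollify] using dist_convolution_le (μ := μ) (z₀ := 0) hC
    (mollifierBump n).support_normed_eq.subset (mollifierBump n).nonneg_normed
    (mollifierBump n).integral_normed hg.aestronglyMeasurable
    fun q hq => by simpa using h q (Metric.ball_subset_ball hrOut hq)

theorem mollify_eq_zero (hg : Continuous g) {p : G}
    (hp : p ∉ Metric.cthickening 1 (tsupport g)) (n : ℕ) : mollify μ n g p = 0 := by
  refine norm_le_zero_iff.1 (norm_mollify_le μ hg le_rfl (fun q hq => ?_) n)
  rw [norm_le_zero_iff]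
  refine image_eq_zero_of_notMem_tsupport fun hq' => hp ?_
  exact Metric.mem_cthickening_of_dist_le p q 1 _ hq' (Metric.mem_ball'.1 hq).le

theorem tendsto_integral_mul_mollify {ν : Measure G} {f g : G → ℝ} (hf : LocallyIntegrable f ν)
    (hg : Continuous g) (hgc : HasCompactSupport g) :
    Tendsto (fun n => ∫ p, f p * mollify μ n g p ∂ν) atTop (𝓝 (∫ p, f p * g p ∂ν)) := by
  obtain ⟨C, hC⟩ := hgc.exists_bound_of_continuous hg
  have hC₀ : 0 ≤ C := (norm_nonneg _).trans (hC 0)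
  set K := Metric.cthickening 1 (tsupport g)
  have hK : IsCompact K := hgc.isCompact.cthickening
  refine tendsto_integral_of_dominated_convergence (K.indicator fun p => ‖f p‖ * C)
    (fun n => ?_) ?_ (fun n => Eventually.of_forall fun p => ?_)
    (Eventually.of_forall fun p => (tendsto_mollify μ hg p).const_mul _)
  · exact hf.aestronglyMeasurable.mul
      (contDiff_mollify μ hg.locallyIntegrable n).continuous.aestronglyMeasurable
  · exact (integrable_indicator_iff hK.measurableSet).2
      ((hf.integrableOn_isCompact hK).norm.mul_const C)
  · by_cases hp : p ∈ K
    · rw [indicator_of_mem hp, norm_mul]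
      gcongr
      exact norm_mollify_le μ hg hC₀ (fun q _ => hC q) n
    · simp [indicator_of_notMem hp, mollify_eq_zero μ hg hp]

end Mollification

section WaveOperator

/-- The wave operator `c(x) ∂_t² - ∂_x²`. -/
noncomputable def waveOperator (c : ℝ → ℝ) (φ : ℝ × ℝ → ℝ) (p : ℝ × ℝ) : ℝ :=
  c p.1 * partialSnd (partialSnd φ) p - partialFst (partialFst φ) p

variable {c : ℝ → ℝ} {φ : ℝ × ℝ → ℝ}

theorem continuous_partialFst_partialFst (hφ : ContDiff ℝ 2 φ) :
    Continuous (partialFst (partialFst φ)) :=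
  (contDiff_partialFst (n := 0) (contDiff_partialFst (n := 1) hφ le_rfl) (by simp)).continuous

theorem continuous_partialSnd_partialSnd (hφ : ContDiff ℝ 2 φ) :
    Continuous (partialSnd (partialSnd φ)) :=
  (contDiff_partialSnd (n := 0) (contDiff_partialSnd (n := 1) hφ le_rfl) (by simp)).continuous

theorem waveOperator_congr {ψ : ℝ × ℝ → ℝ} {p : ℝ × ℝ} (h : φ =ᶠ[𝓝 p] ψ) :
    waveOperator c φ p = waveOperator c ψ p := by
  simp only [waveOperator, (eventuallyEq_partialFst (eventuallyEq_partialFst h)).eq_of_nhds,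
    (eventuallyEq_partialSnd (eventuallyEq_partialSnd h)).eq_of_nhds]

theorem partialFst_mollify (hφ : ContDiff ℝ 1 φ) (hφc : HasCompactSupport φ) (n : ℕ) :
    partialFst (mollify volume n φ) = mollify volume n (partialFst φ) :=
  funext fun p => fderiv_mollify_apply volume hφ hφc n p _

theorem partialSnd_mollify (hφ : ContDiff ℝ 1 φ) (hφc : HasCompactSupport φ) (n : ℕ) :
    partialSnd (mollify volume n φ) = mollify volume n (partialSnd φ) :=
  funext fun p => fderiv_mollify_apply volume hφ hφc n p _

theorem integral_mul_waveOperator {f : ℝ × ℝ → ℝ} {ν : Measure (ℝ × ℝ)} (hc : Continuous c)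
    (hf : LocallyIntegrable f ν) (hφ : ContDiff ℝ 2 φ) (hφc : HasCompactSupport φ) :
    ∫ p, f p * waveOperator c φ p ∂ν = ∫ p, f p * c p.1 * partialSnd (partialSnd φ) p ∂ν
      - ∫ p, f p * partialFst (partialFst φ) p ∂ν := by
  simp only [waveOperator, mul_sub, ← mul_assoc]
  exact integral_sub
    ((hf.mul_continuous (hc.comp continuous_fst)).integrable_smul_right_of_hasCompactSupport
      (continuous_partialSnd_partialSnd hφ)
      (hasCompactSupport_partialSnd (hasCompactSupport_partialSnd hφc)))
    (hf.integrable_smul_right_of_hasCompactSupport (continuous_partialFst_partialFst hφ)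
      (hasCompactSupport_partialFst (hasCompactSupport_partialFst hφc)))

theorem tendsto_integral_mul_waveOperator_mollify {f : ℝ × ℝ → ℝ} {ν : Measure (ℝ × ℝ)}
    (hc : Continuous c) (hf : LocallyIntegrable f ν) (hφ : ContDiff ℝ 2 φ)
    (hφc : HasCompactSupport φ) :
    Tendsto (fun n => ∫ p, f p * waveOperator c (mollify volume n φ) p ∂ν) atTop
      (𝓝 (∫ p, f p * waveOperator c φ p ∂ν)) := by
  have hφ1 : ContDiff ℝ 1 φ := hφ.of_le one_le_two
  have hmollify : ∀ n, ContDiff ℝ 2 (mollify volume n φ) := fun n =>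
    contDiff_infty.1 (contDiff_mollify volume hφ.continuous.locallyIntegrable n) 2
  have hFst : ∀ n, partialFst (partialFst (mollify volume n φ))
      = mollify volume n (partialFst (partialFst φ)) := fun n => by
    rw [partialFst_mollify hφ1 hφc, partialFst_mollify (contDiff_partialFst hφ le_rfl)
      (hasCompactSupport_partialFst hφc)]
  have hSnd : ∀ n, partialSnd (partialSnd (mollify volume n φ))
      = mollify volume n (partialSnd (partialSnd φ)) := fun n => by
    rw [partialSnd_mollify hφ1 hφc, partialSnd_mollify (contDiff_partialSnd hφ le_rfl)
      (hasCompactSupport_partialSnd hφc)]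
  simp only [integral_mul_waveOperator hc hf hφ hφc, hFst, hSnd, fun n =>
    integral_mul_waveOperator hc hf (hmollify n) (hasCompactSupport_mollify volume hφc n)]
  exact (tendsto_integral_mul_mollify volume (hf.mul_continuous (hc.comp continuous_fst))
    (continuous_partialSnd_partialSnd hφ)
    (hasCompactSupport_partialSnd (hasCompactSupport_partialSnd hφc))).sub
    (tendsto_integral_mul_mollify volume hf (continuous_partialFst_partialFst hφ)
      (hasCompactSupport_partialFst (hasCompactSupport_partialFst hφc)))

variable {u : ℝ → ℝ → ℝ}

theorem IsWeakWaveSolution.locallyIntegrable_restrict (hu : IsWeakWaveSolution c u) :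
    LocallyIntegrable (fun p : ℝ × ℝ => u p.1 p.2) (volume.restrict (univ ×ˢ Ioi 0)) :=
  ((locallyIntegrableOn_iff_locallyIntegrable_restrict (isClosed_univ.prod isClosed_Ici)).1
    hu.locallyIntegrable).mono_measure
      (Measure.restrict_mono (prod_mono_right Ioi_subset_Ici_self) le_rfl)

theorem IsWeakWaveSolution.integral_mul_waveOperator (hc : Continuous c)
    (hu : IsWeakWaveSolution c u) (hφ : ContDiff ℝ 2 φ) (hφc : HasCompactSupport φ) :
    ∫ p in (univ : Set ℝ) ×ˢ Ioi (0 : ℝ), u p.1 p.2 * waveOperator c φ p = c 0 * φ (0, 0) := by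
  have hsmooth : ∀ n, ∫ p in (univ : Set ℝ) ×ˢ Ioi (0 : ℝ),
      u p.1 p.2 * waveOperator c (mollify volume n φ) p = c 0 * mollify volume n φ (0, 0) := by
    intro n
    have hmollify := contDiff_mollify volume hφ.continuous.locallyIntegrable n
    have hmollify_two : ContDiff ℝ 2 (mollify volume n φ) := contDiff_infty.1 hmollify 2
    simpa only [waveOperator, iteratedDeriv_two_eq_partialFst hmollify_two,
      iteratedDeriv_two_eq_partialSnd hmollify_two]
      using hu.weak_eq _ hmollify (hasCompactSupport_mollify volume hφc n)
  refine tendsto_nhds_unique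
    (tendsto_integral_mul_waveOperator_mollify hc hu.locallyIntegrable_restrict hφ hφc) ?_
  simpa only [hsmooth] using (tendsto_mollify volume hφ.continuous _).const_mul (c 0)

theorem IsWeakWaveSolution.integral_mul_waveOperator_of_eq_zero (hc : Continuous c)
    (hu : IsWeakWaveSolution c u) (hφ : ContDiff ℝ 2 φ) {S : Set (ℝ × ℝ)} (hS : IsCompact S)
    (hφS : ∀ p : ℝ × ℝ, -1 ≤ p.2 → p ∉ S → φ p = 0) :
    ∫ p in (univ : Set ℝ) ×ˢ Ioi (0 : ℝ), u p.1 p.2 * waveOperator c φ p = c 0 * φ (0, 0) := by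
  -- Only the values of `φ` for `t ≥ 0` enter, so `φ` may be cut off at `t = -1`.
  set χ : ℝ × ℝ → ℝ := fun p => Real.smoothTransition (p.2 + 1) * φ p
  have hχ : ContDiff ℝ 2 χ :=
    (Real.smoothTransition.contDiff.comp (contDiff_snd.add contDiff_const)).mul hφ
  have hχc : HasCompactSupport χ := HasCompactSupport.intro hS fun p hp => by
    rcases le_total p.2 (-1) with h | h
    · exact mul_eq_zero_of_left (Real.smoothTransition.zero_of_nonpos (by linarith)) _
    · exact mul_eq_zero_of_right _ (hφS p h hp)
  have hχφ : ∀ p : ℝ × ℝ, 0 ≤ p.2 → χ p = φ p := fun p hp => by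
    rw [show χ p = _ * _ from rfl, Real.smoothTransition.one_of_one_le (by linarith), one_mul]
  rw [← hχφ (0, 0) le_rfl, ← hu.integral_mul_waveOperator hc hχ hχc]
  refine setIntegral_congr_fun (MeasurableSet.univ.prod measurableSet_Ioi) fun p hp => ?_
  have heq : φ =ᶠ[𝓝 p] χ := by
    filter_upwards [(isOpen_lt continuous_const continuous_snd).mem_nhds hp.2] with p' hp'
    exact (hχφ p' (le_of_lt hp')).symm
  simp only [waveOperator_congr heq]

end WaveOperator

section Amplitude

/-- The factor `c^(-1/4)` by which the amplitude of a high-frequency wave, and in particular the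
jump of `u` across the wave front, varies with the position. -/
noncomputable def amplitude (c : ℝ → ℝ) (x : ℝ) : ℝ := c x ^ (-(1 / 4) : ℝ)

variable {c : ℝ → ℝ} {n : WithTop ℕ∞}

theorem amplitude_pos {x : ℝ} (hx : 0 < c x) : 0 < amplitude c x := Real.rpow_pos_of_pos hx _

theorem amplitude_ne_zero {x : ℝ} (hx : 0 < c x) : amplitude c x ≠ 0 := (amplitude_pos hx).ne'

theorem contDiff_amplitude (hc : ContDiff ℝ n c) (hpos : ∀ x, 0 < c x) :
    ContDiff ℝ n (amplitude c) :=
  hc.rpow_const_of_ne fun x => (hpos x).ne'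

theorem amplitude_pow_four {x : ℝ} (hx : 0 < c x) : amplitude c x ^ 4 = (c x)⁻¹ := by
  rw [amplitude, ← Real.rpow_natCast, ← Real.rpow_mul hx.le, ← Real.rpow_neg_one]
  norm_num

theorem eq_inv_amplitude_pow_four {x : ℝ} (hx : 0 < c x) : c x = (amplitude c x ^ 4)⁻¹ := by
  rw [amplitude_pow_four hx, inv_inv]

theorem sqrt_eq_inv_amplitude_sq {x : ℝ} (hx : 0 < c x) : √(c x) = (amplitude c x ^ 2)⁻¹ := by
  have ha := amplitude_pos hx
  rw [Real.sqrt_eq_iff_mul_self_eq hx.le (by positivity), ← mul_inv, ← pow_add,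
    amplitude_pow_four hx, inv_inv]

end Amplitude

section TravelTime

variable {c : ℝ → ℝ}

theorem travelTime_zero (c : ℝ → ℝ) : travelTime c 0 = 0 := intervalIntegral.integral_same

theorem hasDerivAt_travelTime (hc : Continuous c) (x : ℝ) :
    HasDerivAt (travelTime c) (√(c x)) x :=
  (hc.sqrt.integral_hasStrictDerivAt 0 x).hasDerivAt

theorem deriv_travelTime (hc : Continuous c) : deriv (travelTime c) = fun x => √(c x) :=
  funext fun x => (hasDerivAt_travelTime hc x).deriv

theorem continuous_travelTime (hc : Continuous c) : Continuous (travelTime c) :=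
  continuous_iff_continuousAt.2 fun x => (hasDerivAt_travelTime hc x).continuousAt

theorem contDiff_travelTime {n : ℕ} (hc : ContDiff ℝ n c) (hpos : ∀ x, 0 < c x) :
    ContDiff ℝ (n + 1) (travelTime c) := by
  rw [contDiff_succ_iff_deriv, deriv_travelTime hc.continuous]
  exact ⟨fun x => (hasDerivAt_travelTime hc.continuous x).differentiableAt, by simp,
    hc.sqrt fun x => (hpos x).ne'⟩

theorem strictMono_travelTime (hc : Continuous c) (hpos : ∀ x, 0 < c x) :
    StrictMono (travelTime c) :=
  strictMono_of_deriv_pos fun x => by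
    rw [deriv_travelTime hc]
    exact Real.sqrt_pos.2 (hpos x)

theorem travelTime_nonneg {x : ℝ} (hx : 0 ≤ x) : 0 ≤ travelTime c x :=
  intervalIntegral.integral_nonneg hx fun _ _ => Real.sqrt_nonneg _

theorem surjective_travelTime (hc : Continuous c) {m : ℝ} (hm : 0 < m) (hmc : ∀ x, m ≤ c x) :
    Function.Surjective (travelTime c) := by
  have hgrowth : ∀ x y, x ≤ y → √m * (y - x) ≤ travelTime c y - travelTime c x :=
    fun x y hxy => mul_sub_le_image_sub_of_le_deriv
      (fun x => (hasDerivAt_travelTime hc x).differentiableAt)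
      (fun x => by rw [deriv_travelTime hc]; exact Real.sqrt_le_sqrt (hmc x)) hxy
  have hsqrt : 0 < √m := Real.sqrt_pos.2 hm
  refine (continuous_travelTime hc).surjective ?_ ?_
  · refine tendsto_atTop_mono' _ ?_ (tendsto_id.const_mul_atTop hsqrt)
    filter_upwards [eventually_ge_atTop 0] with x hx
    simpa [travelTime_zero] using hgrowth 0 x hx
  · refine tendsto_atBot_mono' _ ?_ (tendsto_id.const_mul_atBot hsqrt)
    filter_upwards [eventually_le_atBot 0] with x hx
    simpa [travelTime_zero] using hgrowth x 0 hx

theorem travelTime_eq_self {x : ℝ} (hx : 0 ≤ x) (h : ∀ s ∈ Ico 0 x, c s = 1) :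
    travelTime c x = x := by
  have heq : travelTime c x = ∫ _ in (0 : ℝ)..x, (1 : ℝ) := by
    rw [travelTime, intervalIntegral.integral_of_le hx, intervalIntegral.integral_of_le hx,
      ← integral_Ico_eq_integral_Ioc, ← integral_Ico_eq_integral_Ioc]
    exact setIntegral_congr_fun measurableSet_Ico fun s hs => by simp only [h s hs, Real.sqrt_one]
  simpa using heq

/-- The position reached after a given signed travel time. Inverse to `travelTime c` as soon as
the latter is a bijection of the line; a junk function otherwise. -/
noncomputable def travelTimeInv (c : ℝ → ℝ) : ℝ → ℝ := Function.invFun (travelTime c)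

theorem travelTimeInv_travelTime (hc : Continuous c) (hpos : ∀ x, 0 < c x) (x : ℝ) :
    travelTimeInv c (travelTime c x) = x :=
  Function.leftInverse_invFun (strictMono_travelTime hc hpos).injective x

theorem travelTime_travelTimeInv (hτ : Function.Surjective (travelTime c)) (y : ℝ) :
    travelTime c (travelTimeInv c y) = y :=
  Function.rightInverse_invFun hτ y

theorem contDiff_travelTimeInv {n : ℕ} (hc : ContDiff ℝ n c) (hpos : ∀ x, 0 < c x)
    (hτ : Function.Surjective (travelTime c)) : ContDiff ℝ (n + 1) (travelTimeInv c) := by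
  let e := ((strictMono_travelTime hc.continuous hpos).orderIsoOfSurjective _ hτ).toHomeomorph
  have he : ⇑e.symm = travelTimeInv c := funext fun y => e.injective <| by
    rw [e.apply_symm_apply]
    exact (travelTime_travelTimeInv hτ y).symm
  rw [← he]
  exact e.contDiff_symm_deriv (fun x => (Real.sqrt_pos.2 (hpos x)).ne')
    (hasDerivAt_travelTime hc.continuous) (contDiff_travelTime hc hpos)

end TravelTime

section CharacteristicCoordinates

variable {c : ℝ → ℝ}

/-- The characteristic coordinates `(t + τ(x), t - τ(x))` of the point `(x, t)`. -/
noncomputable def charCoord (c : ℝ → ℝ) (p : ℝ × ℝ) : ℝ × ℝ :=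
  (p.2 + travelTime c p.1, p.2 - travelTime c p.1)

/-- The point with given characteristic coordinates, see `travelTimeInv`. -/
noncomputable def charCoordInv (c : ℝ → ℝ) (q : ℝ × ℝ) : ℝ × ℝ :=
  (travelTimeInv c ((q.1 - q.2) / 2), (q.1 + q.2) / 2)

/-- The region `t ≥ |τ(x)|` behind the wave front, front included. -/
def forwardCone (c : ℝ → ℝ) : Set (ℝ × ℝ) := {p | |travelTime c p.1| ≤ p.2}

theorem charCoordInv_charCoord (hc : Continuous c) (hpos : ∀ x, 0 < c x) (p : ℝ × ℝ) :
    charCoordInv c (charCoord c p) = p := by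
  have hfst : (p.2 + travelTime c p.1 - (p.2 - travelTime c p.1)) / 2 = travelTime c p.1 := by ring
  have hsnd : (p.2 + travelTime c p.1 + (p.2 - travelTime c p.1)) / 2 = p.2 := by ring
  simp only [charCoord, charCoordInv, hfst, hsnd, travelTimeInv_travelTime hc hpos, Prod.mk.eta]

theorem charCoord_charCoordInv (hτ : Function.Surjective (travelTime c)) (q : ℝ × ℝ) :
    charCoord c (charCoordInv c q) = q := by
  have hfst : (q.1 + q.2) / 2 + (q.1 - q.2) / 2 = q.1 := by ring
  have hsnd : (q.1 + q.2) / 2 - (q.1 - q.2) / 2 = q.2 := by ring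
  simp only [charCoord, charCoordInv, travelTime_travelTimeInv hτ, hfst, hsnd, Prod.mk.eta]

theorem contDiff_charCoord {n : ℕ} (hc : ContDiff ℝ n c) (hpos : ∀ x, 0 < c x) :
    ContDiff ℝ (n + 1) (charCoord c) := by
  have hτ := contDiff_travelTime hc hpos
  unfold charCoord
  fun_prop

theorem contDiff_charCoordInv {n : ℕ} (hc : ContDiff ℝ n c) (hpos : ∀ x, 0 < c x)
    (hτ : Function.Surjective (travelTime c)) : ContDiff ℝ (n + 1) (charCoordInv c) := by
  have hσ := contDiff_travelTimeInv hc hpos hτ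
  unfold charCoordInv
  fun_prop

theorem charCoord_preimage_Ici_prod_Ici (c : ℝ → ℝ) :
    charCoord c ⁻¹' (Ici 0 ×ˢ Ici 0) = forwardCone c := by
  ext p
  simp only [charCoord, forwardCone, mem_preimage, mem_prod, mem_Ici, mem_ofPred_eq, abs_le]
  constructor <;> rintro ⟨h₁, h₂⟩ <;> constructor <;> linarith

theorem measurableSet_forwardCone (hc : Continuous c) : MeasurableSet (forwardCone c) :=
  (isClosed_le ((continuous_travelTime hc).comp continuous_fst).abs
    continuous_snd).measurableSet

theorem hasFDerivAt_charCoord (hc : Continuous c) (p : ℝ × ℝ) :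
    HasFDerivAt (charCoord c) (Matrix.toLin (.finTwoProd ℝ) (.finTwoProd ℝ)
      !![√(c p.1), 1; -√(c p.1), 1]).toContinuousLinearMap p := by
  rw [Matrix.toLin_finTwoProd_toContinuousLinearMap]
  have hfst : HasFDerivAt (fun p : ℝ × ℝ => travelTime c p.1)
      (√(c p.1) • ContinuousLinearMap.fst ℝ ℝ ℝ) p :=
    (hasDerivAt_travelTime hc p.1).comp_hasFDerivAt p hasFDerivAt_fst
  have hsnd : HasFDerivAt (fun p : ℝ × ℝ => p.2) (ContinuousLinearMap.snd ℝ ℝ ℝ) p :=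
    hasFDerivAt_snd
  convert! (hsnd.add hfst).prodMk (hsnd.sub hfst) using 2
  · rw [one_smul, add_comm]
  · module

theorem integral_Ici_prod_Ici_eq_integral_forwardCone (hc : Continuous c) (hpos : ∀ x, 0 < c x)
    (hτ : Function.Surjective (travelTime c)) (g : ℝ × ℝ → ℝ) :
    ∫ q in Ici (0 : ℝ) ×ˢ Ici (0 : ℝ), g q
      = ∫ p in forwardCone c, 2 * √(c p.1) * g (charCoord c p) := by
  have hdet : ∀ p : ℝ × ℝ, |(Matrix.toLin (.finTwoProd ℝ) (.finTwoProd ℝ)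
      !![√(c p.1), 1; -√(c p.1), 1]).toContinuousLinearMap.det| = 2 * √(c p.1) := fun p => by
    rw [LinearMap.det_toContinuousLinearMap, LinearMap.det_toLin, Matrix.det_fin_two_of,
      abs_of_nonneg (by linarith [Real.sqrt_nonneg (c p.1)])]
    ring
  rw [← image_preimage_eq (Ici (0 : ℝ) ×ˢ Ici (0 : ℝ))
      (Function.RightInverse.surjective (charCoord_charCoordInv hτ)),
    charCoord_preimage_Ici_prod_Ici,
    integral_image_eq_integral_abs_det_fderiv_smul volume (measurableSet_forwardCone hc)
      (fun p _ => (hasFDerivAt_charCoord hc p).hasFDerivWithinAt)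
      (Function.LeftInverse.injective (charCoordInv_charCoord hc hpos)).injOn g]
  simp only [hdet, smul_eq_mul]

end CharacteristicCoordinates

section Liouville

variable {c : ℝ → ℝ} {Ω : ℝ × ℝ → ℝ}

/-- The potential `c^(-3/4) (c^(-1/4))'' / 4` produced by the Liouville transformation, as a
function of the position. -/
noncomputable def liouvillePotential (c : ℝ → ℝ) (x : ℝ) : ℝ :=
  amplitude c x ^ 3 * deriv (deriv (amplitude c)) x / 4

/-- The potential of the Liouville transformation in characteristic coordinates. -/
noncomputable def charPotential (c : ℝ → ℝ) (q : ℝ × ℝ) : ℝ :=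
  liouvillePotential c (charCoordInv c q).1

/-- The Liouville transformation, which removes the first-order terms of the wave operator in
characteristic coordinates. -/
noncomputable def liouvilleTransform (c : ℝ → ℝ) (Ω : ℝ × ℝ → ℝ) (p : ℝ × ℝ) : ℝ :=
  amplitude c p.1 * Ω (charCoord c p)

theorem contDiff_liouvillePotential {n : WithTop ℕ∞} (hc : ContDiff ℝ (n + 1 + 1) c)
    (hpos : ∀ x, 0 < c x) : ContDiff ℝ n (liouvillePotential c) := by
  have ha := contDiff_amplitude hc hpos
  exact ((ha.of_le (by simp [add_assoc])).pow 3).mul ha.deriv'.deriv' |>.div_const 4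

theorem contDiff_charPotential {n : ℕ} (hc : ContDiff ℝ (n + 1 + 1) c) (hpos : ∀ x, 0 < c x)
    (hτ : Function.Surjective (travelTime c)) : ContDiff ℝ n (charPotential c) :=
  (contDiff_liouvillePotential hc hpos).comp <| contDiff_fst.comp <|
    (contDiff_charCoordInv (n := n) (hc.of_le (by simp [add_assoc])) hpos hτ).of_le (by simp)

theorem contDiff_liouvilleTransform {n : ℕ} (hc : ContDiff ℝ n c) (hpos : ∀ x, 0 < c x)
    (hΩ : ContDiff ℝ n Ω) : ContDiff ℝ n (liouvilleTransform c Ω) :=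
  ((contDiff_amplitude hc hpos).comp contDiff_fst).mul
    (hΩ.comp ((contDiff_charCoord hc hpos).of_le (by simp)))

theorem hasDerivAt_comp_charCoord_fst (hc : Continuous c) {p : ℝ × ℝ}
    (hΩ : DifferentiableAt ℝ Ω (charCoord c p)) :
    HasDerivAt (fun x => Ω (charCoord c (x, p.2)))
      (√(c p.1) * (partialFst Ω (charCoord c p) - partialSnd Ω (charCoord c p))) p.1 :=
  (hasDerivAt_comp_curve (α := fun x => p.2 + travelTime c x) (β := fun x => p.2 - travelTime c x)
    hΩ ((hasDerivAt_travelTime hc p.1).const_add p.2)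
    ((hasDerivAt_travelTime hc p.1).const_sub p.2)).congr_deriv
      (by simp only [charCoord, smul_eq_mul]; ring)

theorem hasDerivAt_comp_charCoord_snd {p : ℝ × ℝ} (hΩ : DifferentiableAt ℝ Ω (charCoord c p)) :
    HasDerivAt (fun t => Ω (charCoord c (p.1, t)))
      (partialFst Ω (charCoord c p) + partialSnd Ω (charCoord c p)) p.2 :=
  (hasDerivAt_comp_curve (α := fun t => t + travelTime c p.1) (β := fun t => t - travelTime c p.1)
    hΩ ((hasDerivAt_id p.2).add_const _) ((hasDerivAt_id p.2).sub_const _)).congr_deriv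
      (by simp only [charCoord, one_smul])

theorem partialSnd_liouvilleTransform (hc : ContDiff ℝ 1 c) (hpos : ∀ x, 0 < c x)
    (hΩ : ContDiff ℝ 1 Ω) (p : ℝ × ℝ) :
    partialSnd (liouvilleTransform c Ω) p
      = amplitude c p.1 * (partialFst Ω (charCoord c p) + partialSnd Ω (charCoord c p)) :=
  (hasDerivAt_partialSnd ((contDiff_liouvilleTransform hc hpos hΩ).differentiable one_ne_zero p)
    ).unique ((hasDerivAt_comp_charCoord_snd (c := c) (p := p)
      (hΩ.differentiable one_ne_zero _)).const_mul (amplitude c p.1))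

theorem partialFst_liouvilleTransform (hc : ContDiff ℝ 1 c) (hpos : ∀ x, 0 < c x)
    (hΩ : ContDiff ℝ 1 Ω) (p : ℝ × ℝ) :
    partialFst (liouvilleTransform c Ω) p = deriv (amplitude c) p.1 * Ω (charCoord c p)
      + (amplitude c p.1)⁻¹ * (partialFst Ω (charCoord c p) - partialSnd Ω (charCoord c p)) := by
  have ha := (contDiff_amplitude hc hpos).differentiable one_ne_zero
  refine ((hasDerivAt_partialFst ((contDiff_liouvilleTransform hc hpos hΩ).differentiable
    one_ne_zero p)).unique ((ha p.1).hasDerivAt.mul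
      (hasDerivAt_comp_charCoord_fst hc.continuous (p := p)
        (hΩ.differentiable one_ne_zero _)))).trans ?_
  have ha₀ := amplitude_ne_zero (hpos p.1)
  rw [sqrt_eq_inv_amplitude_sq (hpos p.1)]
  field_simp

theorem partialSnd_partialSnd_liouvilleTransform (hc : ContDiff ℝ 2 c) (hpos : ∀ x, 0 < c x)
    (hΩ : ContDiff ℝ 2 Ω) (p : ℝ × ℝ) :
    partialSnd (partialSnd (liouvilleTransform c Ω)) p
      = amplitude c p.1 * (partialFst (partialFst Ω) (charCoord c p)
        + 2 * partialSnd (partialFst Ω) (charCoord c p)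
        + partialSnd (partialSnd Ω) (charCoord c p)) := by
  have htransform :=
    contDiff_partialSnd (n := 1) (contDiff_liouvilleTransform hc hpos hΩ) (by norm_num)
  have hΩ₁ := (contDiff_partialFst (n := 1) hΩ (by norm_num)).differentiable one_ne_zero
  have hΩ₂ := (contDiff_partialSnd (n := 1) hΩ (by norm_num)).differentiable one_ne_zero
  have hderiv := ((hasDerivAt_comp_charCoord_snd (c := c) (p := p) (hΩ₁ _)).add
    (hasDerivAt_comp_charCoord_snd (c := c) (p := p) (hΩ₂ _))).const_mul (amplitude c p.1)
  rw [(hasDerivAt_partialSnd (htransform.differentiable one_ne_zero p)).unique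
      (hderiv.congr_of_eventuallyEq (Eventually.of_forall fun t => partialSnd_liouvilleTransform
        (hc.of_le one_le_two) hpos (hΩ.of_le one_le_two) (p.1, t))),
    partialFst_partialSnd_comm hΩ]
  ring

theorem partialFst_partialFst_liouvilleTransform (hc : ContDiff ℝ 2 c) (hpos : ∀ x, 0 < c x)
    (hΩ : ContDiff ℝ 2 Ω) (p : ℝ × ℝ) :
    partialFst (partialFst (liouvilleTransform c Ω)) p
      = deriv (deriv (amplitude c)) p.1 * Ω (charCoord c p)
        + (amplitude c p.1 ^ 3)⁻¹ * (partialFst (partialFst Ω) (charCoord c p)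
          - 2 * partialSnd (partialFst Ω) (charCoord c p)
          + partialSnd (partialSnd Ω) (charCoord c p)) := by
  have ha₀ := amplitude_ne_zero (hpos p.1)
  have ha := contDiff_amplitude hc hpos
  have ha' : HasDerivAt (deriv (amplitude c)) (deriv (deriv (amplitude c)) p.1) p.1 :=
    ((ha.deriv' (n := 1)).differentiable one_ne_zero p.1).hasDerivAt
  have htransform :=
    contDiff_partialFst (n := 1) (contDiff_liouvilleTransform hc hpos hΩ) (by norm_num)
  have hΩ₁ := (contDiff_partialFst (n := 1) hΩ (by norm_num)).differentiable one_ne_zero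
  have hΩ₂ := (contDiff_partialSnd (n := 1) hΩ (by norm_num)).differentiable one_ne_zero
  have hderiv := (ha'.mul (hasDerivAt_comp_charCoord_fst hc.continuous (p := p)
      (hΩ.differentiable two_ne_zero _))).add
    (((ha.differentiable two_ne_zero p.1).hasDerivAt.inv ha₀).mul
      ((hasDerivAt_comp_charCoord_fst hc.continuous (p := p) (hΩ₁ _)).sub
        (hasDerivAt_comp_charCoord_fst hc.continuous (p := p) (hΩ₂ _))))
  rw [(hasDerivAt_partialFst (htransform.differentiable one_ne_zero p)).unique
      (hderiv.congr_of_eventuallyEq (Eventually.of_forall fun x => partialFst_liouvilleTransform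
        (hc.of_le one_le_two) hpos (hΩ.of_le one_le_two) (x, p.2))),
    partialFst_partialSnd_comm hΩ, sqrt_eq_inv_amplitude_sq (hpos p.1)]
  simp only [Pi.inv_apply, Pi.sub_apply]
  field_simp
  ring

theorem waveOperator_liouvilleTransform (hc : ContDiff ℝ 2 c) (hpos : ∀ x, 0 < c x)
    (hΩ : ContDiff ℝ 2 Ω) (p : ℝ × ℝ) :
    waveOperator c (liouvilleTransform c Ω) p = 4 / amplitude c p.1 ^ 3
      * (partialSnd (partialFst Ω) (charCoord c p)
        - charPotential c (charCoord c p) * Ω (charCoord c p)) := by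
  have ha₀ := amplitude_ne_zero (hpos p.1)
  rw [waveOperator, partialSnd_partialSnd_liouvilleTransform hc hpos hΩ,
    partialFst_partialFst_liouvilleTransform hc hpos hΩ, charPotential,
    charCoordInv_charCoord hc.continuous hpos, liouvillePotential,
    eq_inv_amplitude_pow_four (hpos p.1)]
  field_simp
  ring

end Liouville

section LinearGoursat

open scoped NNReal

theorem lipschitzWith_add_mul {k : ℝ} {K : ℝ≥0} (hk : ‖k‖₊ ≤ K) (a : ℝ) :
    LipschitzWith K fun w => a + k * w :=
  LipschitzWith.of_dist_le_mul fun w z => by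
    rw [dist_add_left, dist_eq_norm, ← mul_sub, norm_mul, ← dist_eq_norm]
    gcongr
    exact hk

theorem exists_goursat_linear {F κ : ℝ × ℝ → ℝ} (hF : ContDiff ℝ 1 F) (hκ : ContDiff ℝ 1 κ)
    {C : ℝ} (hFC : ∀ p, ‖F p‖ ≤ C) {K : ℝ≥0} (hκK : ∀ p, ‖κ p‖₊ ≤ K) (w₀ : ℝ) (p₀ : ℝ × ℝ) :
    ∃ W : ℝ × ℝ → ℝ, ContDiff ℝ 2 W ∧ (∀ r, W (p₀.1, r) = w₀) ∧ (∀ s, W (s, p₀.2) = w₀) ∧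
      (∀ p, partialSnd (partialFst W) p = F p + κ p * W p) ∧
      ((∀ p : ℝ × ℝ, p₀.1 ≤ p.1 ∨ p₀.2 ≤ p.2 → F p + κ p * w₀ = 0) →
        ∀ p : ℝ × ℝ, p₀.1 ≤ p.1 ∨ p₀.2 ≤ p.2 → W p = w₀) := by
  refine exists_goursat (f := fun p w => F p + κ p * w) (K := K) (C := C + K * ‖w₀‖) ?_
    (fun p => lipschitzWith_add_mul (hκK p) (F p)) fun p => (norm_add_le _ _).trans ?_
  · exact (hF.comp contDiff_fst).add ((hκ.comp contDiff_fst).mul contDiff_snd)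
  · rw [norm_mul]
    gcongr
    exacts [hFC p, hκK p]

end LinearGoursat

section RiemannFunction

open scoped NNReal

variable {c : ℝ → ℝ} {V W ψ : ℝ × ℝ → ℝ} {K : ℝ≥0} {R : ℝ}

/-- `V` is the Riemann function of the wave equation with source at `0`: it solves the Goursat
problem for `∂₂∂₁V = κV` with `κ = charPotential c` and data constant on both characteristics
through the source. The constant is the one for which the Liouville transform of `V`, cut off
ahead of the front, has the initial velocity `δ₀`. -/
structure IsRiemannFunction (c : ℝ → ℝ) (V : ℝ × ℝ → ℝ) : Prop where
  contDiff : ContDiff ℝ 2 V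
  eq_fst : ∀ r, V (0, r) = c 0 * amplitude c 0 / 2
  eq_snd : ∀ s, V (s, 0) = c 0 * amplitude c 0 / 2
  goursat : ∀ q, partialSnd (partialFst V) q = charPotential c q * V q

theorem exists_isRiemannFunction (hc : ContDiff ℝ 3 c) (hpos : ∀ x, 0 < c x)
    (hτ : Function.Surjective (travelTime c)) (hK : ∀ x, ‖liouvillePotential c x‖₊ ≤ K) :
    ∃ V, IsRiemannFunction c V := by
  have hκ : ContDiff ℝ 1 (charPotential c) :=
    contDiff_charPotential (n := 1) (hc.of_le (by norm_num)) hpos hτ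
  obtain ⟨V, hV, hfst, hsnd, hgoursat, -⟩ := exists_goursat_linear (contDiff_const (c := (0 : ℝ)))
    hκ (fun _ => norm_zero.le) (fun q => hK _) (c 0 * amplitude c 0 / 2) 0
  exact ⟨V, hV, hfst, hsnd, fun q => by rw [hgoursat, zero_add]⟩

theorem IsRiemannFunction.partialFst_eq_zero (hV : IsRiemannFunction c V) {s r : ℝ} (hr : 0 ≤ r)
    (hκ : ∀ y ∈ Ico 0 r, charPotential c (s, y) = 0) : partialFst V (s, r) = 0 := by
  have hedge : partialFst V (s, 0) = 0 := by
    simpa [hV.eq_snd] using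
      (hasDerivAt_partialFst (hV.contDiff.differentiable two_ne_zero (s, 0))).deriv.symm
  have hderiv : ∀ y, HasDerivAt (fun y => partialFst V (s, y)) _ y := fun y =>
    hasDerivAt_partialSnd
      ((contDiff_partialFst (n := 1) hV.contDiff le_rfl).differentiable one_ne_zero (s, y))
  rw [← hedge]
  refine constant_of_has_deriv_right_zero (f := fun y => partialFst V (s, y))
    (fun y _ => (hderiv y).continuousAt.continuousWithinAt) (fun y hy => ?_) r ⟨hr, le_rfl⟩
  have hzero : partialSnd (partialFst V) (s, y) = 0 := by rw [hV.goursat, hκ y hy, zero_mul]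
  exact hzero ▸ (hderiv y).hasDerivWithinAt

theorem exists_eq_zero_of_le_charCoord (hc : Continuous c) (hψc : HasCompactSupport ψ) :
    ∃ R, 0 ≤ R ∧ ∀ p, R ≤ (charCoord c p).1 ∨ R ≤ (charCoord c p).2 → ψ p = 0 := by
  have hτ := continuous_travelTime hc
  have hcont : Continuous (charCoord c) := by
    unfold charCoord
    fun_prop
  obtain ⟨B, hB⟩ := hψc.exists_bound_of_continuousOn hcont.continuousOn
  refine ⟨|B| + 1, by positivity, fun p hp => ?_⟩
  by_contra hne
  have hle := hB p (subset_tsupport _ hne)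
  have hfst := (le_abs_self _).trans ((norm_fst_le (charCoord c p)).trans hle)
  have hsnd := (le_abs_self _).trans ((norm_snd_le (charCoord c p)).trans hle)
  rcases hp with hp | hp <;> linarith [le_abs_self B]

theorem exists_waveOperator_liouvilleTransform_eq (hc : ContDiff ℝ 3 c) (hpos : ∀ x, 0 < c x)
    (hτ : Function.Surjective (travelTime c)) (hK : ∀ x, ‖liouvillePotential c x‖₊ ≤ K)
    (hψ : ContDiff ℝ 1 ψ) (hψc : HasCompactSupport ψ) :
    ∃ (R : ℝ) (W : ℝ × ℝ → ℝ), 0 ≤ R ∧ ContDiff ℝ 2 W ∧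
      (∀ q : ℝ × ℝ, R ≤ q.1 ∨ R ≤ q.2 → W q = 0) ∧
      waveOperator c (liouvilleTransform c W) = ψ := by
  obtain ⟨R, hR, hψR⟩ := exists_eq_zero_of_le_charCoord hc.continuous hψc
  set f : ℝ × ℝ → ℝ := fun p => amplitude c p.1 ^ 3 * ψ p / 4 with hf
  have hf1 : ContDiff ℝ 1 f := by
    have ha := contDiff_amplitude (hc.of_le (m := 1) (by norm_num)) hpos
    fun_prop
  have hfc : HasCompactSupport f := HasCompactSupport.intro hψc fun p hp => by
    simp [hf, image_eq_zero_of_notMem_tsupport hp]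
  obtain ⟨C, hC⟩ := hfc.exists_bound_of_continuous hf1.continuous
  have hinv : ContDiff ℝ 1 (charCoordInv c) := by
    simpa using contDiff_charCoordInv (n := 0) (hc.of_le (by simp)) hpos hτ
  have hzero : ∀ q : ℝ × ℝ, R ≤ q.1 ∨ R ≤ q.2 → f (charCoordInv c q) = 0 := fun q hq => by
    simp only [hf, hψR (charCoordInv c q) (by rwa [charCoord_charCoordInv hτ]), mul_zero, zero_div]
  obtain ⟨W, hW, -, -, hWgoursat, hWR⟩ := exists_goursat_linear (hf1.comp hinv)
    (contDiff_charPotential (n := 1) (hc.of_le (by norm_num)) hpos hτ) (fun q => hC _)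
    (fun q => hK _) 0 (R, R)
  refine ⟨R, W, hR, hW, hWR fun q hq => ?_, funext fun p => ?_⟩
  · rw [Function.comp_apply, hzero q hq, mul_zero, add_zero]
  · have ha := amplitude_ne_zero (hpos p.1)
    rw [waveOperator_liouvilleTransform (hc.of_le (by norm_num)) hpos hW, hWgoursat,
      Function.comp_apply, charCoordInv_charCoord hc.continuous hpos, hf]
    field_simp
    ring

theorem isCompact_image_charCoordInv_Icc (hc : Continuous c) (hpos : ∀ x, 0 < c x)
    (hτ : Function.Surjective (travelTime c)) (a b : ℝ × ℝ) :
    IsCompact (charCoordInv c '' Icc a b) :=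
  isCompact_Icc.image
    (contDiff_charCoordInv (n := 0) (contDiff_zero.2 hc) hpos hτ).continuous

theorem IsWeakWaveSolution.integral_mul_waveOperator_liouvilleTransform {u : ℝ → ℝ → ℝ}
    (hu : IsWeakWaveSolution c u) (hc : ContDiff ℝ 2 c) (hpos : ∀ x, 0 < c x)
    (hτ : Function.Surjective (travelTime c)) (hW : ContDiff ℝ 2 W)
    (hWR : ∀ q : ℝ × ℝ, R ≤ q.1 ∨ R ≤ q.2 → W q = 0) :
    ∫ p in (univ : Set ℝ) ×ˢ Ioi (0 : ℝ), u p.1 p.2 * waveOperator c (liouvilleTransform c W) p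
      = c 0 * amplitude c 0 * W (0, 0) := by
  rw [hu.integral_mul_waveOperator_of_eq_zero hc.continuous
    (contDiff_liouvilleTransform hc hpos hW)
    (isCompact_image_charCoordInv_Icc hc.continuous hpos hτ (-2 - R, -2 - R) (R, R)) ?_]
  · simp only [liouvilleTransform, charCoord, travelTime_zero, add_zero, sub_zero, mul_assoc]
  · intro p hp hpS
    refine mul_eq_zero_of_right _ (hWR _ ?_)
    by_contra! hlt
    refine hpS ⟨charCoord c p, ⟨⟨?_, ?_⟩, hlt.1.le, hlt.2.le⟩,
      charCoordInv_charCoord hc.continuous hpos p⟩ <;>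
    · simp only [charCoord] at hlt ⊢
      linarith [hlt.1, hlt.2]

theorem integral_forwardCone_liouvilleTransform_mul_waveOperator (hc : ContDiff ℝ 2 c)
    (hpos : ∀ x, 0 < c x) (hτ : Function.Surjective (travelTime c)) (hV : IsRiemannFunction c V)
    (hW : ContDiff ℝ 2 W) (hR : 0 ≤ R) (hWR : ∀ q : ℝ × ℝ, R ≤ q.1 ∨ R ≤ q.2 → W q = 0) :
    ∫ p in forwardCone c, liouvilleTransform c V p * waveOperator c (liouvilleTransform c W) p
      = c 0 * amplitude c 0 * W (0, 0) := by
  have hpull : ∀ p, liouvilleTransform c V p * waveOperator c (liouvilleTransform c W) p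
      = 2 * √(c p.1) * (2 * (V (charCoord c p) * partialSnd (partialFst W) (charCoord c p)
        - partialSnd (partialFst V) (charCoord c p) * W (charCoord c p))) := fun p => by
    have ha := amplitude_ne_zero (hpos p.1)
    rw [waveOperator_liouvilleTransform hc hpos hW, liouvilleTransform, hV.goursat,
      sqrt_eq_inv_amplitude_sq (hpos p.1)]
    field_simp
    ring
  simp only [hpull]
  rw [← integral_Ici_prod_Ici_eq_integral_forwardCone hc.continuous hpos hτ fun q =>
      2 * (V q * partialSnd (partialFst W) q - partialSnd (partialFst V) q * W q),
    integral_const_mul, integral_green_quadrant hV.contDiff hW hV.eq_fst hV.eq_snd hR hWR]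
  ring

/-- The solution with Riemann function `V`: zero ahead of the front, and the Liouville transform
of `V` behind it. -/
noncomputable def coneSolution (c : ℝ → ℝ) (V : ℝ × ℝ → ℝ) : ℝ × ℝ → ℝ :=
  (forwardCone c).indicator (liouvilleTransform c V)

theorem locallyIntegrable_coneSolution (hc : Continuous c) (hpos : ∀ x, 0 < c x)
    (hV : Continuous V) : LocallyIntegrable (coneSolution c V) volume :=
  (contDiff_zero.1 (contDiff_liouvilleTransform (n := 0) (contDiff_zero.2 hc) hpos
    (contDiff_zero.2 hV))).locallyIntegrable.indicator (measurableSet_forwardCone hc)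

theorem integral_coneSolution_mul (hc : Continuous c) (g : ℝ × ℝ → ℝ) :
    ∫ p in (univ : Set ℝ) ×ˢ Ioi (0 : ℝ), coneSolution c V p * g p
      = ∫ p in forwardCone c, liouvilleTransform c V p * g p := by
  have hIci : ((univ : Set ℝ) ×ˢ Ioi (0 : ℝ) : Set (ℝ × ℝ)) =ᵐ[volume] univ ×ˢ Ici 0 :=
    Measure.set_prod_ae_eq (ae_eq_refl _) Ioi_ae_eq_Ici
  have hsub : forwardCone c ⊆ univ ×ˢ Ici 0 := fun p hp =>
    ⟨mem_univ _, (abs_nonneg (travelTime c p.1)).trans hp⟩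
  rw [setIntegral_congr_set hIci, setIntegral_eq_of_subset_of_forall_sdiff_eq_zero
    (MeasurableSet.univ.prod measurableSet_Ici) hsub fun p hp => by
      rw [coneSolution, indicator_of_notMem hp.2, zero_mul]]
  exact setIntegral_congr_fun (measurableSet_forwardCone hc) fun p hp => by
    simp only [coneSolution, indicator_of_mem hp]

theorem IsWeakWaveSolution.integral_mul_eq_integral_coneSolution_mul {u : ℝ → ℝ → ℝ}
    (hu : IsWeakWaveSolution c u) (hc : ContDiff ℝ 3 c) (hpos : ∀ x, 0 < c x)
    (hτ : Function.Surjective (travelTime c)) (hK : ∀ x, ‖liouvillePotential c x‖₊ ≤ K)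
    (hV : IsRiemannFunction c V) (hψ : ContDiff ℝ 1 ψ) (hψc : HasCompactSupport ψ) :
    ∫ p in (univ : Set ℝ) ×ˢ Ioi (0 : ℝ), u p.1 p.2 * ψ p
      = ∫ p in (univ : Set ℝ) ×ˢ Ioi (0 : ℝ), coneSolution c V p * ψ p := by
  have hc₂ : ContDiff ℝ 2 c := hc.of_le (by norm_num)
  obtain ⟨R, W, hR, hW, hWR, rfl⟩ :=
    exists_waveOperator_liouvilleTransform_eq hc hpos hτ hK hψ hψc
  rw [hu.integral_mul_waveOperator_liouvilleTransform hc₂ hpos hτ hW hWR,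
    integral_coneSolution_mul hc.continuous,
    integral_forwardCone_liouvilleTransform_mul_waveOperator hc₂ hpos hτ hV hW hR hWR]

theorem IsWeakWaveSolution.coneSolution_ae_eq {u : ℝ → ℝ → ℝ}
    (hu : IsWeakWaveSolution c u) (hc : ContDiff ℝ 3 c) (hpos : ∀ x, 0 < c x)
    (hτ : Function.Surjective (travelTime c)) (hK : ∀ x, ‖liouvillePotential c x‖₊ ≤ K)
    (hV : IsRiemannFunction c V) :
    coneSolution c V =ᵐ[volume.restrict (univ ×ˢ Ioi 0)] fun p => u p.1 p.2 := by
  have hU := (locallyIntegrable_coneSolution hc.continuous hpos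
    hV.contDiff.continuous).mono_measure (Measure.restrict_le_self (s := univ ×ˢ Ioi 0))
  have hloc := hU.sub hu.locallyIntegrable_restrict
  have hzero := ae_eq_zero_of_integral_contDiff_smul_eq_zero hloc fun ψ hψ hψc => ?_
  · filter_upwards [hzero] with p hp
    exact sub_eq_zero.1 hp
  · have hsplit : ∀ p : ℝ × ℝ, ψ p • (coneSolution c V - fun p : ℝ × ℝ => u p.1 p.2) p
        = coneSolution c V p • ψ p - u p.1 p.2 • ψ p := fun p => by
      simp only [smul_eq_mul, Pi.sub_apply]
      ring
    simp only [hsplit]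
    rw [integral_sub (hU.integrable_smul_right_of_hasCompactSupport hψ.continuous hψc)
      (hu.locallyIntegrable_restrict.integrable_smul_right_of_hasCompactSupport hψ.continuous hψc)]
    simp only [smul_eq_mul]
    rw [hu.integral_mul_eq_integral_coneSolution_mul hc hpos hτ hK hV
      (hψ.of_le (by exact_mod_cast le_top)) hψc, sub_self]

theorem IsWeakWaveSolution.isPointwiseVersion_coneSolution {u : ℝ → ℝ → ℝ}
    (hu : IsWeakWaveSolution c u) (hc : ContDiff ℝ 3 c) (hpos : ∀ x, 0 < c x)
    (hτ : Function.Surjective (travelTime c)) (hK : ∀ x, ‖liouvillePotential c x‖₊ ≤ K)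
    (hV : IsRiemannFunction c V) :
    IsPointwiseVersion c u fun x t => coneSolution c V (x, t) where
  ae_eq := hu.coneSolution_ae_eq hc hpos hτ hK hV
  continuousOn := (contDiff_liouvilleTransform (n := 2) (hc.of_le (by norm_num)) hpos
    hV.contDiff).continuous.continuousOn.congr fun _ hp => indicator_of_mem hp _
  eq_zero x t hxt := indicator_of_notMem (s := forwardCone c) (not_le.2 hxt) _

end RiemannFunction

section PointwiseVersion

variable {c : ℝ → ℝ} {u U₁ U₂ : ℝ → ℝ → ℝ}

theorem forwardCone_subset_closure (c : ℝ → ℝ) :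
    forwardCone c ⊆ closure {p | |travelTime c p.1| < p.2} := fun p hp => by
  have hlim : Tendsto (fun s : ℝ => (p.1, p.2 + s)) (𝓝[>] 0) (𝓝 p) := by
    have hcont : Continuous fun s : ℝ => (p.1, p.2 + s) := by fun_prop
    simpa using (hcont.tendsto 0).mono_left nhdsWithin_le_nhds
  refine mem_closure_of_tendsto hlim ?_
  filter_upwards [self_mem_nhdsWithin] with s hs
  exact lt_add_of_le_of_pos hp hs

theorem IsPointwiseVersion.eq (hc : Continuous c) (h₁ : IsPointwiseVersion c u U₁)
    (h₂ : IsPointwiseVersion c u U₂) : U₁ = U₂ := by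
  ext x t
  rcases lt_or_ge t |travelTime c x| with hlt | hle
  · rw [h₁.eq_zero _ _ hlt, h₂.eq_zero _ _ hlt]
  have hτ := continuous_travelTime hc
  have hopen : IsOpen {p : ℝ × ℝ | |travelTime c p.1| < p.2} :=
    isOpen_lt (by fun_prop) continuous_snd
  have hsub : {p : ℝ × ℝ | |travelTime c p.1| < p.2} ⊆ univ ×ˢ Ioi 0 := fun p hp =>
    ⟨mem_univ _, (abs_nonneg (travelTime c p.1)).trans_lt hp⟩
  have hcone : {p : ℝ × ℝ | |travelTime c p.1| < p.2} ⊆ forwardCone c := fun p hp =>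
    le_of_lt (show |travelTime c p.1| < p.2 from hp)
  have heq := Measure.eqOn_open_of_ae_eq
    (ae_restrict_of_ae_restrict_of_subset hsub (h₁.ae_eq.trans h₂.ae_eq.symm)) hopen
    (h₁.continuousOn.mono hcone) (h₂.continuousOn.mono hcone)
  exact heq.of_subset_closure h₁.continuousOn h₂.continuousOn hcone
    (forwardCone_subset_closure c) (show (x, t) ∈ forwardCone c from hle)

end PointwiseVersion

section Retarded

variable {c : ℝ → ℝ} {φ V : ℝ × ℝ → ℝ}

/-- `φ` as a function of the position and of the time elapsed since the passage of the front
`t = τ(x)`. -/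
noncomputable def retarded (c : ℝ → ℝ) (φ : ℝ × ℝ → ℝ) (p : ℝ × ℝ) : ℝ :=
  φ (p.1, p.2 + travelTime c p.1)

theorem contDiff_retarded {n : ℕ} (hc : ContDiff ℝ n c) (hpos : ∀ x, 0 < c x)
    (hφ : ContDiff ℝ n φ) : ContDiff ℝ n (retarded c φ) := by
  have hτ : ContDiff ℝ n (travelTime c) := (contDiff_travelTime hc hpos).of_le (by simp)
  unfold retarded
  fun_prop

theorem hasDerivAt_retarded_fst (hc : Continuous c) (hφ : Differentiable ℝ φ) (p : ℝ × ℝ) :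
    HasDerivAt (fun x => retarded c φ (x, p.2))
      (retarded c (partialFst φ) p + √(c p.1) * retarded c (partialSnd φ) p) p.1 :=
  (hasDerivAt_comp_curve (α := id) (β := fun x => p.2 + travelTime c x) (hφ _) (hasDerivAt_id p.1)
    ((hasDerivAt_travelTime hc p.1).const_add p.2)).congr_deriv
      (by simp only [retarded, id, smul_eq_mul, one_mul])

theorem hasDerivAt_retarded_snd (hφ : Differentiable ℝ φ) (p : ℝ × ℝ) :
    HasDerivAt (fun t => retarded c φ (p.1, t)) (retarded c (partialSnd φ) p) p.2 :=
  (hasDerivAt_partialSnd (p := (p.1, p.2 + travelTime c p.1)) (hφ _)).comp_add_const p.2 _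

theorem partialFst_retarded (hc : ContDiff ℝ 1 c) (hpos : ∀ x, 0 < c x) (hφ : ContDiff ℝ 1 φ) :
    partialFst (retarded c φ)
      = fun p => retarded c (partialFst φ) p + √(c p.1) * retarded c (partialSnd φ) p :=
  funext fun p => (hasDerivAt_partialFst
    ((contDiff_retarded hc hpos hφ).differentiable one_ne_zero p)).unique
    (hasDerivAt_retarded_fst hc.continuous (hφ.differentiable one_ne_zero) p)

theorem partialSnd_retarded (hc : ContDiff ℝ 1 c) (hpos : ∀ x, 0 < c x) (hφ : ContDiff ℝ 1 φ) :
    partialSnd (retarded c φ) = retarded c (partialSnd φ) :=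
  funext fun p => (hasDerivAt_partialSnd
    ((contDiff_retarded hc hpos hφ).differentiable one_ne_zero p)).unique
    (hasDerivAt_retarded_snd (hφ.differentiable one_ne_zero) p)

theorem retarded_waveOperator (hc : ContDiff ℝ 2 c) (hpos : ∀ x, 0 < c x) (hφ : ContDiff ℝ 2 φ)
    (p : ℝ × ℝ) :
    retarded c (waveOperator c φ) p
      = 2 * √(c p.1) * partialSnd (partialFst (retarded c φ)) p
        + deriv (fun x => √(c x)) p.1 * partialSnd (retarded c φ) p
        - partialFst (partialFst (retarded c φ)) p := by
  have hc₁ : ContDiff ℝ 1 c := hc.of_le one_le_two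
  have hφ₁ : ContDiff ℝ 1 φ := hφ.of_le one_le_two
  have hFst := (contDiff_partialFst (n := 1) hφ le_rfl).differentiable one_ne_zero
  have hSnd := (contDiff_partialSnd (n := 1) hφ le_rfl).differentiable one_ne_zero
  have hsqrt := ((hc₁.sqrt fun x => (hpos x).ne').differentiable one_ne_zero p.1).hasDerivAt
  have hdiff := (contDiff_partialFst (n := 1) (contDiff_retarded hc hpos hφ) le_rfl).differentiable
    one_ne_zero p
  have hFstFst := hasDerivAt_partialFst hdiff
  have hSndFst := hasDerivAt_partialSnd hdiff
  rw [partialFst_retarded hc₁ hpos hφ₁] at hFstFst hSndFst ⊢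
  rw [hFstFst.unique ((hasDerivAt_retarded_fst hc.continuous hFst p).add
      (hsqrt.mul (hasDerivAt_retarded_fst hc.continuous hSnd p))),
    hSndFst.unique ((hasDerivAt_retarded_snd hFst p).add
      ((hasDerivAt_retarded_snd hSnd p).const_mul √(c p.1))), partialSnd_retarded hc₁ hpos hφ₁]
  simp only [retarded, waveOperator, partialFst_partialSnd_comm hφ]
  linear_combination (Real.mul_self_sqrt (hpos p.1).le).symm
    * partialSnd (partialSnd φ) (p.1, p.2 + travelTime c p.1)

theorem deriv_sqrt_eq (hc : ContDiff ℝ 1 c) (hpos : ∀ x, 0 < c x) (x : ℝ) :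
    deriv (fun x => √(c x)) x = -2 * deriv (amplitude c) x / amplitude c x ^ 3 := by
  have ha := amplitude_ne_zero (hpos x)
  have hderiv := ((contDiff_amplitude hc hpos).differentiable one_ne_zero x).hasDerivAt
  simp only [fun x => sqrt_eq_inv_amplitude_sq (hpos x)]
  refine ((hderiv.pow 2).inv (pow_ne_zero 2 ha)).deriv.trans ?_
  simp only [Pi.pow_apply]
  field_simp
  ring

theorem retarded_liouvilleTransform_zero (hV : IsRiemannFunction c V) (hc₀ : c 0 = 1) (x : ℝ) :
    retarded c (liouvilleTransform c V) (x, 0) = amplitude c x / 2 := by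
  rw [retarded, liouvilleTransform, charCoord]
  simp only [zero_add, sub_self, hV.eq_snd, amplitude, hc₀, Real.one_rpow]
  ring

theorem partialFst_retarded_liouvilleTransform (hc : ContDiff ℝ 1 c) (hpos : ∀ x, 0 < c x)
    (hV : ContDiff ℝ 1 V) (p : ℝ × ℝ) :
    partialFst (retarded c (liouvilleTransform c V)) p
      = deriv (amplitude c) p.1 * V (p.2 + 2 * travelTime c p.1, p.2)
        + 2 * (amplitude c p.1)⁻¹ * partialFst V (p.2 + 2 * travelTime c p.1, p.2) := by
  have ha := amplitude_ne_zero (hpos p.1)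
  have hchar : charCoord c (p.1, p.2 + travelTime c p.1) = (p.2 + 2 * travelTime c p.1, p.2) := by
    simp only [charCoord, add_sub_cancel_right]
    ring_nf
  rw [partialFst_retarded hc hpos (contDiff_liouvilleTransform hc hpos hV)]
  simp only [retarded, partialFst_liouvilleTransform hc hpos hV,
    partialSnd_liouvilleTransform hc hpos hV, sqrt_eq_inv_amplitude_sq (hpos p.1), hchar]
  field_simp
  ring

end Retarded

section Quadrant

variable {c : ℝ → ℝ} {q : ℝ → ℝ → ℝ} {Q V : ℝ × ℝ → ℝ}

theorem deriv_fst_of_eqOn_quadrant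
    (h : EqOn (fun p : ℝ × ℝ => q p.1 p.2) Q (Ioi 0 ×ˢ Ici 0)) (hQ : Differentiable ℝ Q)
    {x t : ℝ} (hx : 0 < x) (ht : 0 ≤ t) : deriv (fun y => q y t) x = partialFst Q (x, t) :=
  ((hasDerivAt_partialFst (hQ (x, t))).congr_of_eventuallyEq <| by
    filter_upwards [lt_mem_nhds hx] with y hy
    exact h (x := (y, t)) ⟨hy, ht⟩).deriv

theorem deriv_snd_of_eqOn_quadrant
    (h : EqOn (fun p : ℝ × ℝ => q p.1 p.2) Q (Ioi 0 ×ˢ Ici 0)) (hQ : Differentiable ℝ Q)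
    {x t : ℝ} (hx : 0 < x) (ht : 0 < t) : deriv (fun s => q x s) t = partialSnd Q (x, t) :=
  ((hasDerivAt_partialSnd (hQ (x, t))).congr_of_eventuallyEq <| by
    filter_upwards [lt_mem_nhds ht] with s hs
    exact h (x := (x, s)) ⟨hx, le_of_lt hs⟩).deriv

theorem contDiffOn_of_eqOn_retarded (hc : ContDiff ℝ 2 c) (hpos : ∀ x, 0 < c x)
    (hV : ContDiff ℝ 2 V)
    (h : EqOn (fun p : ℝ × ℝ => q p.1 p.2) (retarded c (liouvilleTransform c V))
      (Ioi 0 ×ˢ Ici 0)) :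
    ContDiffOn ℝ 2 (fun p : ℝ × ℝ => q p.1 p.2) (Ioi 0 ×ˢ Ici 0) :=
  (contDiff_retarded (n := 2) hc hpos
    (contDiff_liouvilleTransform hc hpos hV)).contDiffOn.congr h

theorem eq_amplitude_half_of_eqOn_retarded (hV : IsRiemannFunction c V) (hc₀ : c 0 = 1)
    (h : EqOn (fun p : ℝ × ℝ => q p.1 p.2) (retarded c (liouvilleTransform c V)) (Ioi 0 ×ˢ Ici 0))
    {x : ℝ} (hx : 0 < x) : q x 0 = amplitude c x / 2 :=
  (h (x := (x, 0)) ⟨hx, self_mem_Ici⟩).trans (retarded_liouvilleTransform_zero hV hc₀ x)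

theorem le_front_of_eqOn_retarded (hV : IsRiemannFunction c V) (hc₀ : c 0 = 1)
    (h : EqOn (fun p : ℝ × ℝ => q p.1 p.2) (retarded c (liouvilleTransform c V)) (Ioi 0 ×ˢ Ici 0))
    {x C : ℝ} (hx : 0 < x) (hcx : 0 < c x) (hxC : c x ≤ C) :
    1 / (2 * C ^ (1 / 4 : ℝ)) ≤ q x 0 := by
  rw [eq_amplitude_half_of_eqOn_retarded hV hc₀ h hx, amplitude, Real.rpow_neg hcx.le, ← one_div,
    div_div, mul_comm _ (2 : ℝ)]
  gcongr

theorem eq_one_div_front_pow_of_eqOn_retarded (hV : IsRiemannFunction c V) (hc₀ : c 0 = 1)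
    (h : EqOn (fun p : ℝ × ℝ => q p.1 p.2) (retarded c (liouvilleTransform c V)) (Ioi 0 ×ˢ Ici 0))
    {x : ℝ} (hx : 0 < x) (hcx : 0 < c x) : c x = 1 / (16 * q x 0 ^ 4) := by
  rw [eq_amplitude_half_of_eqOn_retarded hV hc₀ h hx, div_pow, amplitude_pow_four hcx]
  field_simp
  norm_num

theorem retarded_wave_equation_of_eqOn_retarded (hc : ContDiff ℝ 2 c) (hpos : ∀ x, 0 < c x)
    (hV : IsRiemannFunction c V) (hc₀ : c 0 = 1)
    (h : EqOn (fun p : ℝ × ℝ => q p.1 p.2) (retarded c (liouvilleTransform c V)) (Ioi 0 ×ˢ Ici 0))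
    {x t : ℝ} (hx : 0 < x) (ht : 0 < t) :
    deriv (fun y => deriv (fun z => q z t) y) x
      - deriv (fun s => deriv (fun y => q y s) x) t / (2 * q x 0 ^ 2)
      + deriv (fun s => q x s) t * deriv (fun y => q y 0) x / (2 * q x 0 ^ 3) = 0 := by
  have hφ := contDiff_liouvilleTransform (n := 2) hc hpos hV.contDiff
  have hQ := contDiff_retarded (n := 2) hc hpos hφ
  have hQ₁ := (contDiff_partialFst (n := 1) hQ le_rfl).differentiable one_ne_zero
  have hqx : EqOn (fun p : ℝ × ℝ => deriv (fun y => q y p.2) p.1)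
      (partialFst (retarded c (liouvilleTransform c V))) (Ioi 0 ×ˢ Ici 0) := fun p hp =>
    deriv_fst_of_eqOn_quadrant h (hQ.differentiable two_ne_zero) hp.1 hp.2
  have hfront : (fun y => q y 0) =ᶠ[𝓝 x] fun y => amplitude c y / 2 := by
    filter_upwards [lt_mem_nhds hx] with y hy
    exact eq_amplitude_half_of_eqOn_retarded hV hc₀ h hy
  have hqx₀ : deriv (fun y => q y 0) x = deriv (amplitude c) x / 2 := by
    rw [hfront.deriv_eq, deriv_div_const]
  have hwave := retarded_waveOperator hc hpos hφ (x, t)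
  rw [retarded, waveOperator_liouvilleTransform hc hpos hV.contDiff, hV.goursat, sub_self, mul_zero,
    deriv_sqrt_eq (hc.of_le one_le_two) hpos, sqrt_eq_inv_amplitude_sq (hpos x)] at hwave
  rw [deriv_fst_of_eqOn_quadrant (q := fun y s => deriv (fun z => q z s) y) hqx hQ₁ hx ht.le,
    deriv_snd_of_eqOn_quadrant (q := fun y s => deriv (fun z => q z s) y) hqx hQ₁ hx ht,
    deriv_snd_of_eqOn_quadrant h (hQ.differentiable two_ne_zero) hx ht, hqx₀,
    eq_amplitude_half_of_eqOn_retarded hV hc₀ h hx]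
  have ha := amplitude_ne_zero (hpos x)
  field_simp at hwave ⊢
  linear_combination hwave

end Quadrant

section BehindFront

variable {c : ℝ → ℝ} {φ : ℝ × ℝ → ℝ} {U : ℝ → ℝ → ℝ} {x t : ℝ}

theorem eqOn_retarded_of_eqOn_forwardCone
    (h : EqOn (fun p : ℝ × ℝ => U p.1 p.2) φ (forwardCone c)) :
    EqOn (fun p : ℝ × ℝ => U p.1 (p.2 + travelTime c p.1)) (retarded c φ) (Ioi 0 ×ˢ Ici 0) :=
  fun p hp => h (x := (p.1, p.2 + travelTime c p.1)) <| by
    rw [forwardCone, mem_ofPred_eq, abs_of_nonneg (travelTime_nonneg (le_of_lt hp.1))]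
    exact le_add_of_nonneg_left hp.2

theorem hasDerivAt_fst_of_eqOn_forwardCone (hc : Continuous c)
    (h : EqOn (fun p : ℝ × ℝ => U p.1 p.2) φ (forwardCone c)) (hφ : Differentiable ℝ φ)
    (ht : |travelTime c x| < t) : HasDerivAt (fun y => U y t) (partialFst φ (x, t)) x := by
  refine (hasDerivAt_partialFst (hφ (x, t))).congr_of_eventuallyEq ?_
  filter_upwards [(continuous_travelTime hc).abs.continuousAt.eventually_lt continuousAt_const ht]
    with y hy
  exact h (x := (y, t)) (le_of_lt hy)

theorem hasDerivAt_snd_of_eqOn_forwardCone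
    (h : EqOn (fun p : ℝ × ℝ => U p.1 p.2) φ (forwardCone c)) (hφ : Differentiable ℝ φ)
    (ht : |travelTime c x| < t) : HasDerivAt (U x) (partialSnd φ (x, t)) t := by
  refine (hasDerivAt_partialSnd (hφ (x, t))).congr_of_eventuallyEq ?_
  filter_upwards [lt_mem_nhds ht] with s hs
  exact h (x := (x, s)) (le_of_lt hs)

theorem tendsto_deriv_fst_of_eqOn_forwardCone (hc : Continuous c)
    (h : EqOn (fun p : ℝ × ℝ => U p.1 p.2) φ (forwardCone c)) (hφ : ContDiff ℝ 1 φ) :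
    Tendsto (fun t => deriv (fun y => U y t) x) (𝓝[>] |travelTime c x|)
      (𝓝 (partialFst φ (x, |travelTime c x|))) := by
  have hcont : Continuous fun t => partialFst φ (x, t) :=
    (contDiff_partialFst (n := 0) hφ (by simp)).continuous.comp (by fun_prop)
  refine ((hcont.tendsto _).mono_left nhdsWithin_le_nhds).congr' ?_
  filter_upwards [self_mem_nhdsWithin] with t ht
  exact (hasDerivAt_fst_of_eqOn_forwardCone hc h (hφ.differentiable one_ne_zero) ht).deriv.symm

theorem tendsto_deriv_snd_of_eqOn_forwardCone
    (h : EqOn (fun p : ℝ × ℝ => U p.1 p.2) φ (forwardCone c)) (hφ : ContDiff ℝ 1 φ) :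
    Tendsto (deriv (U x)) (𝓝[>] |travelTime c x|) (𝓝 (partialSnd φ (x, |travelTime c x|))) := by
  have hcont : Continuous fun t => partialSnd φ (x, t) :=
    (contDiff_partialSnd (n := 0) hφ (by simp)).continuous.comp (by fun_prop)
  refine ((hcont.tendsto _).mono_left nhdsWithin_le_nhds).congr' ?_
  filter_upwards [self_mem_nhdsWithin] with t ht
  exact (hasDerivAt_snd_of_eqOn_forwardCone h (hφ.differentiable one_ne_zero) ht).deriv.symm

theorem deriv_fst_retarded_of_eqOn_forwardCone (hc : ContDiff ℝ 1 c) (hpos : ∀ x, 0 < c x)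
    (h : EqOn (fun p : ℝ × ℝ => U p.1 p.2) φ (forwardCone c)) (hφ : ContDiff ℝ 1 φ)
    (hx : 0 < x) (ht : 0 ≤ t) :
    deriv (fun y => U y (t + travelTime c y)) x = partialFst φ (x, t + travelTime c x)
      + √(c x) * partialSnd φ (x, t + travelTime c x) := by
  rw [deriv_fst_of_eqOn_quadrant (q := fun y s => U y (s + travelTime c y))
    (eqOn_retarded_of_eqOn_forwardCone h)
    ((contDiff_retarded hc hpos hφ).differentiable one_ne_zero) hx ht,
    partialFst_retarded hc hpos hφ]
  rfl

theorem deriv_fst_retarded_eq_add_of_eqOn_forwardCone (hc : ContDiff ℝ 1 c) (hpos : ∀ x, 0 < c x)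
    (h : EqOn (fun p : ℝ × ℝ => U p.1 p.2) φ (forwardCone c)) (hφ : ContDiff ℝ 1 φ)
    (hx : 0 < x) (ht : 0 < t) :
    DifferentiableAt ℝ (fun y => U y (t + travelTime c x)) x ∧
      DifferentiableAt ℝ (U x) (t + travelTime c x) ∧
      deriv (fun y => U y (t + travelTime c y)) x
        = deriv (fun y => U y (t + travelTime c x)) x
          + √(c x) * deriv (U x) (t + travelTime c x) := by
  have hφ₁ := hφ.differentiable one_ne_zero
  have hbehind : |travelTime c x| < t + travelTime c x := by
    rw [abs_of_nonneg (travelTime_nonneg hx.le)]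
    exact lt_add_of_pos_left _ ht
  have hfst := hasDerivAt_fst_of_eqOn_forwardCone hc.continuous h hφ₁ hbehind
  have hsnd := hasDerivAt_snd_of_eqOn_forwardCone h hφ₁ hbehind
  refine ⟨hfst.differentiableAt, hsnd.differentiableAt, ?_⟩
  rw [deriv_fst_retarded_of_eqOn_forwardCone hc hpos h hφ hx ht.le, hfst.deriv, hsnd.deriv]

theorem exists_tendsto_deriv_front_of_eqOn_forwardCone (hc : ContDiff ℝ 1 c)
    (hpos : ∀ x, 0 < c x) (h : EqOn (fun p : ℝ × ℝ => U p.1 p.2) φ (forwardCone c))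
    (hφ : ContDiff ℝ 1 φ) (hx : 0 < x) :
    ∃ a b : ℝ, Tendsto (fun t => deriv (fun y => U y t) x) (𝓝[>] travelTime c x) (𝓝 a) ∧
      Tendsto (deriv (U x)) (𝓝[>] travelTime c x) (𝓝 b) ∧
      deriv (fun y => U y (0 + travelTime c y)) x = a + √(c x) * b := by
  have hfst := tendsto_deriv_fst_of_eqOn_forwardCone (x := x) hc.continuous h hφ
  have hsnd := tendsto_deriv_snd_of_eqOn_forwardCone (x := x) h hφ
  rw [abs_of_nonneg (travelTime_nonneg hx.le)] at hfst hsnd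
  refine ⟨_, _, hfst, hsnd, ?_⟩
  rw [deriv_fst_retarded_of_eqOn_forwardCone hc hpos h hφ hx le_rfl, zero_add]

end BehindFront

section Medium

open scoped NNReal

variable {c : ℝ → ℝ} {V : ℝ × ℝ → ℝ} {x k ε M : ℝ}

theorem deriv_amplitude_eq_zero (h : c =ᶠ[𝓝 x] fun _ => k) : deriv (amplitude c) x = 0 :=
  (h.fun_comp fun y => y ^ (-(1 / 4) : ℝ)).deriv_eq.trans (deriv_const x _)

theorem liouvillePotential_eq_zero (h : c =ᶠ[𝓝 x] fun _ => k) : liouvillePotential c x = 0 := by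
  have hderiv : deriv (amplitude c) =ᶠ[𝓝 x] fun _ => 0 :=
    h.eventuallyEq_nhds.mono fun _ => deriv_amplitude_eq_zero
  rw [liouvillePotential, hderiv.deriv_eq, deriv_const, mul_zero, zero_div]

theorem eventuallyEq_of_eq_off_Icc (h : ∀ x, x ∉ Icc ε M → c x = k) (hx : x ∉ Icc ε M) :
    c =ᶠ[𝓝 x] fun _ => k :=
  mem_of_superset (isClosed_Icc.isOpen_compl.mem_nhds hx) h

theorem eq_off_Ioo_of_eq_off_Icc {f : ℝ → ℝ} (hf : Continuous f)
    (h : ∀ x, x ∉ Icc ε M → f x = k) (hx : x ∉ Ioo ε M) : f x = k := by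
  have heq : EqOn f (fun _ => k) (closure (Icc ε M)ᶜ) := EqOn.closure h hf continuous_const
  rw [closure_compl, interior_Icc] at heq
  exact heq hx

theorem exists_nnnorm_liouvillePotential_le (hc : ContDiff ℝ 2 c) (hpos : ∀ x, 0 < c x)
    (h : ∀ x, x ∉ Icc ε M → c x = k) : ∃ K : ℝ≥0, ∀ x, ‖liouvillePotential c x‖₊ ≤ K := by
  have hcont : Continuous (liouvillePotential c) :=
    (contDiff_liouvillePotential (n := 0) (by simpa [one_add_one_eq_two] using hc) hpos).continuous
  have hsupp : HasCompactSupport (liouvillePotential c) := HasCompactSupport.intro isCompact_Icc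
    fun x hx => liouvillePotential_eq_zero (eventuallyEq_of_eq_off_Icc h hx)
  obtain ⟨C, hC⟩ := hsupp.exists_bound_of_continuous hcont
  exact ⟨C.toNNReal, fun x => NNReal.le_toNNReal_of_coe_le (hC x)⟩

theorem min_le_of_eq_off_Icc {m : ℝ} (hm : ∀ x ∈ Icc ε M, m ≤ c x)
    (h : ∀ x, x ∉ Icc ε M → c x = k) (x : ℝ) : min m k ≤ c x := by
  by_cases hx : x ∈ Icc ε M
  · exact min_le_of_left_le (hm x hx)
  · exact min_le_of_right_le (h x hx).ge

theorem IsWeakWaveSolution.exists_eqOn_liouvilleTransform {u : ℝ → ℝ → ℝ}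
    (hu : IsWeakWaveSolution c u) (hc : ContDiff ℝ 3 c) (hpos : ∀ x, 0 < c x)
    (hτ : Function.Surjective (travelTime c)) (h : ∀ x, x ∉ Icc ε M → c x = k) :
    ∃ V, IsRiemannFunction c V ∧ (∃ U, IsPointwiseVersion c u U) ∧
      ∀ U, IsPointwiseVersion c u U →
        EqOn (fun p : ℝ × ℝ => U p.1 p.2) (liouvilleTransform c V) (forwardCone c) := by
  obtain ⟨K, hK⟩ := exists_nnnorm_liouvillePotential_le (hc.of_le (by norm_num)) hpos h
  obtain ⟨V, hV⟩ := exists_isRiemannFunction hc hpos hτ hK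
  have hver := hu.isPointwiseVersion_coneSolution hc hpos hτ hK hV
  refine ⟨V, hV, ⟨_, hver⟩, fun U hU p hp => ?_⟩
  rw [hU.eq hc.continuous hver]
  exact indicator_of_mem hp _

theorem IsRiemannFunction.partialFst_eq_zero_right (hV : IsRiemannFunction c V)
    (hc : Continuous c) (hpos : ∀ x, 0 < c x) (hτ : Function.Surjective (travelTime c))
    (h : ∀ x, x ∉ Icc ε M → c x = k) {t : ℝ} (ht : 0 ≤ t) :
    partialFst V (t + 2 * travelTime c M, t) = 0 := by
  refine hV.partialFst_eq_zero ht fun y hy => liouvillePotential_eq_zero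
    (eventuallyEq_of_eq_off_Icc h fun hmem => hmem.2.not_gt ?_)
  rw [← (strictMono_travelTime hc hpos).lt_iff_lt, charCoordInv, travelTime_travelTimeInv hτ]
  linarith [hy.2]

theorem deriv_fst_eq_zero_of_eqOn_retarded (hc : ContDiff ℝ 1 c) (hpos : ∀ x, 0 < c x)
    (hτ : Function.Surjective (travelTime c)) (h : ∀ x, x ∉ Icc ε M → c x = k)
    (hV : IsRiemannFunction c V) {q : ℝ → ℝ → ℝ}
    (hq : EqOn (fun p : ℝ × ℝ => q p.1 p.2) (retarded c (liouvilleTransform c V)) (Ioi 0 ×ˢ Ici 0))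
    (hM : 0 < M) {t : ℝ} (ht : 0 ≤ t) : deriv (fun y => q y t) M = 0 := by
  have hV₁ : ContDiff ℝ 1 V := hV.contDiff.of_le one_le_two
  have hQ := contDiff_retarded (n := 1) hc hpos (contDiff_liouvilleTransform hc hpos hV₁)
  have ha : deriv (amplitude c) M = 0 := eq_off_Ioo_of_eq_off_Icc
    ((contDiff_amplitude hc hpos).continuous_deriv le_rfl)
    (fun x hx => deriv_amplitude_eq_zero (eventuallyEq_of_eq_off_Icc h hx)) fun hM => hM.2.false
  rw [deriv_fst_of_eqOn_quadrant hq (hQ.differentiable one_ne_zero) hM ht,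
    partialFst_retarded_liouvilleTransform hc hpos hV₁, ha,
    hV.partialFst_eq_zero_right hc.continuous hpos hτ h ht, zero_mul, mul_zero, add_zero]

end Medium

theorem mainTheorem6
    (ε M T clo chi : ℝ) (hε : 0 < ε) (hεM : ε < M) (hT : 0 < T)
    (hlo : 0 < clo) (hlohi : clo < chi)
    (c : ℝ → ℝ) (hc : ContDiff ℝ 3 c)
    (hc_in : ∀ x ∈ Icc ε M, c x ∈ Icc clo chi)
    (hc_out : ∀ x, x ∉ Icc ε M → c x = 1)
    (u : ℝ → ℝ → ℝ) (hu : IsWeakWaveSolution c u) :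
    -- the solution has a pointwise version ...
    (∃ U : ℝ → ℝ → ℝ, IsPointwiseVersion c u U) ∧
    -- ... and for this version, with `q(x,t) = u(x, t + τ(x))` and the data
    -- `g₀(t) = u(ε,t)`, `g₁(t) = u_x(ε,t)`:
    ∀ U : ℝ → ℝ → ℝ, IsPointwiseVersion c u U →
    ∀ q : ℝ → ℝ → ℝ, (∀ x t, q x t = U x (t + travelTime c x)) →
    ∀ g₀ g₁ : ℝ → ℝ, (∀ t, g₀ t = U ε t) → (∀ t, g₁ t = deriv (fun x => U x t) ε) →
      -- the derivatives of `q` below exist in the classical sense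
      ContDiffOn ℝ 2 (fun p : ℝ × ℝ => q p.1 p.2) (Ioi 0 ×ˢ Ici 0) ∧
      -- the differential equation in `(ε, M) × (0, T)`
      (∀ x ∈ Ioo ε M, ∀ t ∈ Ioo 0 T,
        deriv (fun y => deriv (fun z => q z t) y) x
          - deriv (fun s => deriv (fun y => q y s) x) t / (2 * q x 0 ^ 2)
          + deriv (fun s => q x s) t * deriv (fun y => q y 0) x / (2 * q x 0 ^ 3) = 0) ∧
      -- the lower bound
      (0 < 1 / (2 * chi ^ (1 / 4 : ℝ)) ∧
        ∀ x ∈ Icc ε M, 1 / (2 * chi ^ (1 / 4 : ℝ)) ≤ q x 0) ∧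
      -- the boundary condition for `q` at `x = ε`
      (∀ t ∈ Icc 0 T, q ε t = g₀ (t + ε)) ∧
      -- the boundary condition for `q_x` at `x = ε`, for `0 < t ≤ T` ...
      (∀ t ∈ Ioc 0 T,
        DifferentiableAt ℝ (fun x => U x (t + ε)) ε ∧ DifferentiableAt ℝ g₀ (t + ε) ∧
        deriv (fun y => q y t) ε = g₁ (t + ε) + deriv g₀ (t + ε)) ∧
      -- ... and for `t = 0`, where `g₁(ε)` and `g₀'(ε)` are limits from the right
      (∃ a b : ℝ, Tendsto g₁ (𝓝[>] ε) (𝓝 a) ∧ Tendsto (deriv g₀) (𝓝[>] ε) (𝓝 b) ∧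
        deriv (fun y => q y 0) ε = a + b) ∧
      -- the boundary condition at `x = M`
      (∀ t ∈ Icc 0 T, deriv (fun y => q y t) M = 0) ∧
      -- recovery of the coefficient
      (∀ x ∈ Icc ε M, c x = 1 / (16 * q x 0 ^ 4)) := by
  have hmin := min_le_of_eq_off_Icc (fun x hx => (hc_in x hx).1) hc_out
  have hpos : ∀ x, 0 < c x := fun x => (lt_min hlo one_pos).trans_le (hmin x)
  have hτ := surjective_travelTime hc.continuous (lt_min hlo one_pos) hmin
  have hc₁ : ContDiff ℝ 1 c := hc.of_le (by norm_num)
  have hc₂ : ContDiff ℝ 2 c := hc.of_le (by norm_num)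
  have hc₀ : c 0 = 1 := hc_out 0 fun h => h.1.not_gt hε
  have hcε : c ε = 1 := eq_off_Ioo_of_eq_off_Icc hc.continuous hc_out fun h => h.1.false
  have hτε := travelTime_eq_self hε.le fun s hs => hc_out s fun h => h.1.not_gt hs.2
  obtain ⟨V, hV, hex, hcone⟩ := hu.exists_eqOn_liouvilleTransform hc hpos hτ hc_out
  refine ⟨hex, fun U hU q hq g₀ g₁ hg₀ hg₁ => ?_⟩
  obtain ⟨rfl, rfl⟩ := And.intro (funext hg₀) (funext hg₁)
  have hφ := contDiff_liouvilleTransform (n := 1) hc₁ hpos (hV.contDiff.of_le one_le_two)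
  have hQ : EqOn (fun p : ℝ × ℝ => q p.1 p.2) (retarded c (liouvilleTransform c V))
      (Ioi 0 ×ˢ Ici 0) :=
    fun p hp => (hq p.1 p.2).trans (eqOn_retarded_of_eqOn_forwardCone (hcone U hU) hp)
  refine ⟨contDiffOn_of_eqOn_retarded hc₂ hpos hV.contDiff hQ, fun x hx t ht => ?_,
    ⟨?_, fun x hx => ?_⟩, fun t _ => ?_, fun t ht => ?_, ?_, fun t ht => ?_, fun x hx => ?_⟩
  · exact retarded_wave_equation_of_eqOn_retarded hc₂ hpos hV hc₀ hQ (hε.trans hx.1) ht.1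
  · exact one_div_pos.2 (mul_pos two_pos (Real.rpow_pos_of_pos (hlo.trans hlohi) _))
  · exact le_front_of_eqOn_retarded hV hc₀ hQ (hε.trans_le hx.1) (hpos x) (hc_in x hx).2
  · rw [hq, hτε]
  · simpa only [hq, hτε, hcε, Real.sqrt_one, one_mul] using
      deriv_fst_retarded_eq_add_of_eqOn_forwardCone hc₁ hpos (hcone U hU) hφ hε ht.1
  · simpa only [hq, hτε, hcε, Real.sqrt_one, one_mul] using
      exists_tendsto_deriv_front_of_eqOn_forwardCone hc₁ hpos (hcone U hU) hφ hε
  · exact deriv_fst_eq_zero_of_eqOn_retarded hc₁ hpos hτ hc_out hV hQ (hε.trans hεM) ht.1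
  · exact eq_one_div_front_pow_of_eqOn_retarded hV hc₀ hQ (hε.trans_le hx.1) (hpos x)
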